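/- Let $n,p,m\ge 1$ be integers with $n\ge 2p$, let $B^*\in\mathbb{R}^{p\times m}$ be a (non-random, unknown) signal matrix, let $\Pi^*$ be an $n\times n$ permutation matrix, and let $\sigma>0$. One observes $X$ and $Y=\Pi^*XB^*+W$, where $X\in\mathbb{R}^{n\times p}$ has i.i.d. $\mathcal{N}(0,1)$ entries, $W\in\mathbb{R}^{n\times m}$ has i.i.d. $\mathcal{N}(0,\sigma^2)$ entries, and $X$ and $W$ are independent. Write $\mathsf{snr}=\|B^*\|_F^2/(m\sigma^2)$, where $\|\cdot\|_F$ is the Frobenius norm. The joint least-squares (maximum likelihood) estimator is $$(\widehat\Pi,\widehat B)\in\operatorname{argmin}_{(\Pi,B)}\|Y-\Pi XB\|_F^2,$$ where the minimum is over all $n\times n$ permutation matrices $\Pi$ and all $B\in\mathbb{R}^{p\times m}$. There are universal constants $c_0,c_1,c_3>0$ such that the following holds. For every $\epsilon>0$ there is a constant $N_1(\epsilon)>0$ depending only on $\epsilon$ such that, for all $n,p,m,B^*,\Pi^*,\sigma$ as above with $n>N_1(\epsilon)$, if (i) $\mathsf{snr}\cdot n^{-\frac{2n}{n-p}}\ge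 1$, and (ii) $\log(m\cdot\mathsf{snr})\ge(c_0+c_1\epsilon)\log n$, then with probability exceeding $1-c_3\,n^{-\epsilon}\left[(n^{\epsilon}-1)^{-1}\vee 1\right]$ the ML estimator gives the true permutation, i.e. every minimizer $(\widehat\Pi,\widehat B)$ satisfies $\widehat\Pi=\Pi^*$. -/

import Mathlib

open MeasureTheory ProbabilityTheory
open scoped NNReal

namespace UnlabeledSensing

noncomputable section

/-- The squared Frobenius norm `∑ i j, A i j ^ 2` of a real matrix. -/
def frobSq {k l : ℕ} (A : Matrix (Fin k) (Fin l) ℝ) : ℝ :=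
  ∑ i, ∑ j, A i j ^ 2

/-- The signal-to-noise ratio of the signal matrix `B` (of size `p × m`) at noise level `σ`:
the squared Frobenius norm of `B` divided by `m * σ ^ 2`. -/
def snr {p m : ℕ} (B : Matrix (Fin p) (Fin m) ℝ) (σ : ℝ≥0) : ℝ :=
  frobSq B / ((m : ℝ) * (σ : ℝ) ^ 2)

/-- The observed matrix `Y = Π X B + W`, where `Π` is the permutation matrix of `π`. -/
def observation {n p m : ℕ} (π : Equiv.Perm (Fin n)) (X : Matrix (Fin n) (Fin p) ℝ)
    (B : Matrix (Fin p) (Fin m) ℝ) (W : Matrix (Fin n) (Fin m) ℝ) :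
    Matrix (Fin n) (Fin m) ℝ :=
  π.permMatrix ℝ * X * B + W

/-- `(π, B)` is a joint least-squares (maximum likelihood) estimate for the data `(X, Y)`: it
minimizes the squared Frobenius norm of `Y - Π X B` over all pairs of a permutation and
a signal matrix. -/
def IsMLEstimate {n p m : ℕ} (X : Matrix (Fin n) (Fin p) ℝ) (Y : Matrix (Fin n) (Fin m) ℝ)
    (π : Equiv.Perm (Fin n)) (B : Matrix (Fin p) (Fin m) ℝ) : Prop :=
  ∀ (π' : Equiv.Perm (Fin n)) (B' : Matrix (Fin p) (Fin m) ℝ),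
    frobSq (Y - π.permMatrix ℝ * X * B) ≤ frobSq (Y - π'.permMatrix ℝ * X * B')

/-- The set of all permutations that occur as the first component of a joint ML estimate.
The ML estimate of the permutation is well defined exactly if this set is a singleton. -/
def mlPermutations {n p m : ℕ} (X : Matrix (Fin n) (Fin p) ℝ) (Y : Matrix (Fin n) (Fin m) ℝ) :
    Set (Equiv.Perm (Fin n)) :=
  {π | ∃ B : Matrix (Fin p) (Fin m) ℝ, IsMLEstimate X Y π B}

/-- The random matrices `X` and `W` are a Gaussian design and Gaussian noise of level `σ`: the
entries of `X` are `N(0, 1)`, those of `W` are `N(0, σ ^ 2)`, and all the entries of `X` and `W`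
together are mutually independent. -/
structure IsGaussianDesign {Ω : Type*} [MeasurableSpace Ω] (μ : Measure Ω) {n p m : ℕ}
    (X : Ω → Matrix (Fin n) (Fin p) ℝ) (W : Ω → Matrix (Fin n) (Fin m) ℝ) (σ : ℝ≥0) : Prop where
  law_X : ∀ i j, HasLaw (fun ω => X ω i j) (gaussianReal 0 1) μ
  law_W : ∀ i j, HasLaw (fun ω => W ω i j) (gaussianReal 0 (σ ^ 2)) μ
  indep : iIndepFun
    (Sum.elim (fun (k : Fin n × Fin p) ω => X ω k.1 k.2)
      (fun (k : Fin n × Fin m) ω => W ω k.1 k.2)) μ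

end

end UnlabeledSensing

/-!
Let `q = ⌈n ^ (1 + ε)⌉`. The proof compares powers of `q`: the signal energy `‖B‖²` is at least
`q ^ 310 σ²` by the logarithmic condition, and the terms that stand against it lose to it by smaller
powers of `q`, except with probability of order `n / q ≤ n ^ (-ε)`.

*Reduction.* After undoing `π` on the rows, the data are `X B + W`. Let `P` be the projection onto
the column space of `X` and `P'` the projection onto the column space of `X` with rows permuted by
`τ ≠ 1`. The estimate is exact when `‖(1 - P') (X B + W)‖² > ‖(1 - P) W‖²` for all such `τ`
(`mlPermutations_eq_singleton`). Expanding, the signal `‖(1 - P') X B‖²` has to dominate the cross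
term `2 ⟨(1 - P') X, W Bᵀ⟩` and the term `⟨P - P', W Wᵀ⟩`. Since `P` and `P'` have the same
trace, the latter equals `⟨P - P', W Wᵀ - m σ² 1⟩` (`residual_separation`).

*Noise.* Chebyshev's inequality bounds the entries of `X`, of `W Bᵀ` and of `W Wᵀ - m σ² 1`, the
last ones by `√m σ²` times a power of `q`. These bounds hold for all `τ` at once, so no union bound
over permutations is needed. As `snr ≥ 1`, the factor `√m` is absorbed by `‖B‖`.

*Signal.* A suitable unit vector `v` satisfies `‖B‖² ‖M v‖² ≤ p ‖M B‖²` for all `M`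
(`exists_unit_direction`), so it suffices that `X v` has distance at least `q⁻⁷²` from every
permuted column space (`measure_not_separated_le`). Suppose that `X v` is close to the permuted
`X u`. If `u` is almost parallel to `v`, then `X v` is almost proportional to its own permutation,
necessarily with coefficient near `±1` because both have the same length; the probability of this
decays geometrically in the number of points moved by `τ`, which pays for the number of such
`τ`. If `u` has a component off the line of `v`, that component makes `X u` a vector with `n`
independent Gaussian coordinates given `X v`; the resulting small-ball probability, with exponent
`n`, beats the number of permutations and the size of a grid in the `p + 1 ≤ n / 2 + 1` parameters.
-/

namespace UnlabeledSensing

/-! ### The Frobenius form -/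

lemma frobSq_nonneg {k l : ℕ} (A : Matrix (Fin k) (Fin l) ℝ) : 0 ≤ frobSq A :=
  Finset.sum_nonneg fun _ _ => Finset.sum_nonneg fun _ _ => sq_nonneg _

lemma frobSq_eq_trace {k l : ℕ} (A : Matrix (Fin k) (Fin l) ℝ) :
    frobSq A = (A.transpose * A).trace := by
  simp only [frobSq, Matrix.trace, Matrix.diag, Matrix.mul_apply, Matrix.transpose_apply, ← sq]
  exact Finset.sum_comm

lemma frobSq_add {k l : ℕ} (A B : Matrix (Fin k) (Fin l) ℝ) :
    frobSq (A + B) = frobSq A + 2 * (A.transpose * B).trace + frobSq B := by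
  have h : (B.transpose * A).trace = (A.transpose * B).trace := by
    rw [← Matrix.trace_transpose, Matrix.transpose_mul, Matrix.transpose_transpose]
  simp only [frobSq_eq_trace, Matrix.transpose_add, Matrix.add_mul, Matrix.mul_add,
    Matrix.trace_add, h]
  ring

lemma frobSq_submatrix_perm {k l : ℕ} (A : Matrix (Fin k) (Fin l) ℝ) (τ : Equiv.Perm (Fin k)) :
    frobSq (A.submatrix τ id) = frobSq A :=
  Equiv.sum_comp τ fun i => ∑ j, A i j ^ 2

lemma sq_trace_transpose_mul_le {k l : ℕ} (A B : Matrix (Fin k) (Fin l) ℝ) :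
    (A.transpose * B).trace ^ 2 ≤ frobSq A * frobSq B := by
  have h : (A.transpose * B).trace = ∑ x : Fin k × Fin l, A x.1 x.2 * B x.1 x.2 := by
    simp only [Matrix.trace, Matrix.diag, Matrix.mul_apply, Matrix.transpose_apply]
    rw [Finset.sum_comm, Fintype.sum_prod_type]
  rw [h, frobSq, frobSq, ← Fintype.sum_prod_type' (f := fun i j => A i j ^ 2),
    ← Fintype.sum_prod_type' (f := fun i j => B i j ^ 2)]
  exact Finset.sum_mul_sq_le_sq_mul_sq _ _ _

lemma frobSq_mul_le {k l r : ℕ} (A : Matrix (Fin k) (Fin l) ℝ) (B : Matrix (Fin l) (Fin r) ℝ) :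
    frobSq (A * B) ≤ frobSq A * frobSq B := by
  have h2 : frobSq B = ∑ j, ∑ t, B t j ^ 2 := Finset.sum_comm
  rw [h2, frobSq, frobSq, Finset.sum_mul_sum]
  refine Finset.sum_le_sum fun i _ => Finset.sum_le_sum fun j _ => ?_
  rw [Matrix.mul_apply]
  exact Finset.sum_mul_sq_le_sq_mul_sq _ _ _

lemma frobSq_le_of_abs_le {k l : ℕ} {A : Matrix (Fin k) (Fin l) ℝ} {t : ℝ}
    (h : ∀ i j, |A i j| ≤ t) : frobSq A ≤ k * l * t ^ 2 := by
  have : frobSq A ≤ ∑ _i : Fin k, ∑ _j : Fin l, t ^ 2 :=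
    Finset.sum_le_sum fun i _ => Finset.sum_le_sum fun j _ => sq_le_sq' (by
      linarith [neg_le_of_abs_le (h i j)]) (le_of_abs_le (h i j))
  simpa [mul_assoc] using this

/-! ### Orthogonal projections onto column spaces -/

/-- The orthogonal projection onto the column space of `X`, as a matrix: it is symmetric, fixes
the columns of `X`, and its own columns are combinations of those of `X`. -/
lemma exists_projection {n p : ℕ} (X : Matrix (Fin n) (Fin p) ℝ) :
    ∃ (P : Matrix (Fin n) (Fin n) ℝ) (C : Matrix (Fin p) (Fin n) ℝ),
      P = X * C ∧ P.transpose = P ∧ P * X = X := by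
  classical
  let T := Matrix.toEuclideanLin X
  let K := LinearMap.range T
  let b := fun j : Fin n => (EuclideanSpace.single j (1 : ℝ) : EuclideanSpace ℝ (Fin n))
  have hC : ∀ j, ∃ c : EuclideanSpace ℝ (Fin p), T c = K.starProjection (b j) := fun j =>
    LinearMap.mem_range.1 (K.starProjection_apply_mem _)
  choose c hc using hC
  have happ : ∀ i j, (X * Matrix.of fun k j => c j k) i j =
      inner ℝ (b i) (K.starProjection (b j)) := by
    intro i j
    rw [← hc]
    rw [EuclideanSpace.inner_single_left]
    simp [T, Matrix.mul_apply, Matrix.toLpLin_apply, Matrix.mulVec, dotProduct]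
  refine ⟨_, Matrix.of fun k j => c j k, rfl, ?_, ?_⟩
  · ext i j
    rw [Matrix.transpose_apply, happ, happ, ← Submodule.inner_starProjection_left_eq_right,
      real_inner_comm]
  · ext i k
    have hk : K.starProjection (T (EuclideanSpace.single k 1)) = T (EuclideanSpace.single k 1) :=
      Submodule.starProjection_eq_self_iff.2 (LinearMap.mem_range_self _ _)
    have h1 : T (EuclideanSpace.single k 1) = ∑ j, X j k • b j := by
      ext i
      simp [T, b, Matrix.toLpLin_apply, Pi.single_apply]
    have h2 := congrArg (inner ℝ (b i)) hk
    rw [h1, map_sum, inner_sum, inner_sum] at h2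
    rw [Matrix.mul_apply]
    simp_rw [happ]
    have h3 : ∑ j, inner ℝ (b i) (X j k • b j) = X i k := by
      simp_rw [b, inner_smul_right, EuclideanSpace.inner_single_left]
      simp
    rw [← h3, ← h2]
    refine Finset.sum_congr rfl fun j _ => ?_
    rw [map_smul, inner_smul_right, mul_comm]

/-- For symmetric idempotent `R`, the squared Frobenius norm of `R * M` is a quadratic form. -/
lemma frobSq_symm_idem_mul {n l : ℕ} {R : Matrix (Fin n) (Fin n) ℝ} (hs : R.transpose = R)
    (hi : R * R = R) (M : Matrix (Fin n) (Fin l) ℝ) :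
    frobSq (R * M) = (M.transpose * R * M).trace := by
  rw [frobSq_eq_trace, Matrix.transpose_mul, hs, Matrix.mul_assoc, ← Matrix.mul_assoc R R M, hi,
    Matrix.mul_assoc]

lemma frobSq_symm_idem_le {n : ℕ} {R : Matrix (Fin n) (Fin n) ℝ} (hs : R.transpose = R)
    (hi : R * R = R) : frobSq R ≤ n := by
  have hd : ∀ i, R i i = ∑ j, R i j ^ 2 := by
    intro i
    conv_lhs => rw [← hi, Matrix.mul_apply]
    refine Finset.sum_congr rfl fun j _ => ?_
    rw [sq]
    congr 1
    exact congrFun (congrFun hs i) j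
  have h1 : ∀ i, R i i ≤ 1 := by
    intro i
    have : R i i ^ 2 ≤ R i i := by
      conv_rhs => rw [hd]
      exact Finset.single_le_sum (f := fun j => R i j ^ 2) (fun _ _ => sq_nonneg _)
        (Finset.mem_univ i)
    nlinarith
  calc frobSq R = ∑ i, R i i := Finset.sum_congr rfl fun i _ => (hd i).symm
    _ ≤ ∑ _i : Fin n, (1 : ℝ) := Finset.sum_le_sum fun i _ => h1 i
    _ = n := by simp

/-- Applying a symmetric idempotent to a residual does not increase its norm. -/
lemma frobSq_symm_idem_mul_le {n l : ℕ} {R : Matrix (Fin n) (Fin n) ℝ} (hs : R.transpose = R)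
    (hi : R * R = R) (M : Matrix (Fin n) (Fin l) ℝ) : frobSq (R * M) ≤ frobSq M := by
  have h : M = R * M + (1 - R) * M := by rw [← Matrix.add_mul]; simp
  have h0 : ((R * M).transpose * ((1 - R) * M)).trace = 0 := by
    rw [Matrix.transpose_mul, hs, Matrix.mul_assoc, ← Matrix.mul_assoc R, Matrix.mul_sub, hi]
    simp
  have := frobSq_add (R * M) ((1 - R) * M)
  rw [← h, h0] at this
  linarith [frobSq_nonneg ((1 - R) * M)]

/-- Some unit vector `v` carries at least the average share of the energy of `B`, so that
`‖M v‖²` bounds `‖M B‖²` from below up to the number of rows of `B`. It is obtained by pairing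
`B` with its largest row. -/
lemma exists_unit_direction {p m : ℕ} {B : Matrix (Fin p) (Fin m) ℝ} (hB : 0 < frobSq B) (n : ℕ) :
    ∃ v : Fin p → ℝ, ∑ k, v k ^ 2 = 1 ∧ ∀ M : Matrix (Fin n) (Fin p) ℝ,
      frobSq B * ∑ i, (M.mulVec v) i ^ 2 ≤ p * frobSq (M * B) := by
  have hne : (Finset.univ : Finset (Fin p)).Nonempty := by
    by_contra h
    rw [Finset.not_nonempty_iff_eq_empty] at h
    simp [frobSq, h] at hB
  obtain ⟨i₀, -, hmax⟩ := Finset.exists_max_image Finset.univ (fun i => ∑ j, B i j ^ 2) hne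
  set R := ∑ j, B i₀ j ^ 2 with hR
  have hFR : frobSq B ≤ p * R := by
    have : frobSq B ≤ ∑ _i : Fin p, R := Finset.sum_le_sum fun i _ => hmax i (Finset.mem_univ i)
    simpa using this
  have hR0 : 0 < R := by
    have hp : (0 : ℝ) ≤ p := Nat.cast_nonneg p
    by_contra h
    nlinarith
  set w := B.mulVec (B i₀) with hw
  have hw0 : w i₀ = R := by
    simp [hw, hR, Matrix.mulVec, dotProduct, sq]
  set N := ∑ k, w k ^ 2 with hN
  have hRN : R ^ 2 ≤ N := by
    rw [← hw0]
    exact Finset.single_le_sum (f := fun k => w k ^ 2) (fun _ _ => sq_nonneg _)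
      (Finset.mem_univ i₀)
  have hN0 : 0 < N := lt_of_lt_of_le (by positivity) hRN
  refine ⟨(Real.sqrt N)⁻¹ • w, ?_, fun M => ?_⟩
  · simp only [Pi.smul_apply, smul_eq_mul, mul_pow, inv_pow, Real.sq_sqrt hN0.le,
      ← Finset.mul_sum]
    exact inv_mul_cancel₀ hN0.ne'
  · have hMw : ∑ i, (M.mulVec w) i ^ 2 ≤ frobSq (M * B) * R := by
      rw [hw, Matrix.mulVec_mulVec, frobSq, Finset.sum_mul]
      refine Finset.sum_le_sum fun i _ => ?_
      have := Finset.sum_mul_sq_le_sq_mul_sq Finset.univ (fun j => (M * B) i j) (fun j => B i₀ j)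
      exact this
    simp only [Matrix.mulVec_smul, Pi.smul_apply, smul_eq_mul, mul_pow, inv_pow,
      Real.sq_sqrt hN0.le, ← Finset.mul_sum]
    have hM0 := frobSq_nonneg (M * B)
    have hS0 : 0 ≤ ∑ i, (M.mulVec w) i ^ 2 := Finset.sum_nonneg fun _ _ => sq_nonneg _
    rw [← mul_assoc, mul_comm (frobSq B), mul_assoc, inv_mul_le_iff₀ hN0]
    calc frobSq B * ∑ i, (M.mulVec w) i ^ 2 ≤ (p * R) * (frobSq (M * B) * R) := by gcongr
      _ = R ^ 2 * (p * frobSq (M * B)) := by ring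
      _ ≤ N * (p * frobSq (M * B)) := by gcongr

/-! ### Reduction of exact recovery to a separation of residuals -/

lemma permMatrix_mul_eq_submatrix {n p : ℕ} (π : Equiv.Perm (Fin n))
    (X : Matrix (Fin n) (Fin p) ℝ) : π.permMatrix ℝ * X = X.submatrix π id := by
  simp [Equiv.Perm.permMatrix, PEquiv.toMatrix_toPEquiv_mul]

/-- After undoing the true permutation on the rows, the residual of a candidate permutation `π'`
is the residual of `π' * π⁻¹` for data without permutation. -/
lemma frobSq_observation_sub {n p m : ℕ} (π π' : Equiv.Perm (Fin n))
    (X : Matrix (Fin n) (Fin p) ℝ) (B B' : Matrix (Fin p) (Fin m) ℝ)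
    (W : Matrix (Fin n) (Fin m) ℝ) :
    frobSq (observation π X B W - π'.permMatrix ℝ * X * B') =
      frobSq (X * B + W.submatrix π.symm id -
        X.submatrix (π' * π⁻¹ : Equiv.Perm (Fin n)) id * B') := by
  rw [← frobSq_submatrix_perm _ π.symm, observation, permMatrix_mul_eq_submatrix,
    permMatrix_mul_eq_submatrix]
  congr 1
  ext i j
  simp [Matrix.mul_apply]

lemma one_sub_symm_idem {n : ℕ} {P : Matrix (Fin n) (Fin n) ℝ} (hs : P.transpose = P)
    (hi : P * P = P) : (1 - P).transpose = 1 - P ∧ (1 - P) * (1 - P) = 1 - P := by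
  refine ⟨by simp [hs], ?_⟩
  rw [Matrix.sub_mul, Matrix.mul_sub, Matrix.mul_sub, hi]
  simp

lemma submatrix_symm_idem {n : ℕ} {P : Matrix (Fin n) (Fin n) ℝ} (hs : P.transpose = P)
    (hi : P * P = P) (τ : Equiv.Perm (Fin n)) :
    (P.submatrix τ τ).transpose = P.submatrix τ τ ∧
      P.submatrix τ τ * P.submatrix τ τ = P.submatrix τ τ := by
  refine ⟨by rw [Matrix.transpose_submatrix, hs], ?_⟩
  rw [Matrix.submatrix_mul_equiv, hi]

/-- The ML estimate recovers `π` as soon as the residual of the data off every wrongly permuted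
column space exceeds the residual of the noise off the correct one. -/
lemma mlPermutations_eq_singleton {n p m : ℕ} {X : Matrix (Fin n) (Fin p) ℝ}
    {B : Matrix (Fin p) (Fin m) ℝ} {W : Matrix (Fin n) (Fin m) ℝ} {π : Equiv.Perm (Fin n)}
    {P : Matrix (Fin n) (Fin n) ℝ} {C : Matrix (Fin p) (Fin n) ℝ} (hPC : P = X * C)
    (hPs : P.transpose = P) (hPX : P * X = X)
    (hsep : ∀ τ : Equiv.Perm (Fin n), τ ≠ 1 →
      frobSq ((1 - P) * W.submatrix π.symm id) <
        frobSq ((1 - P.submatrix τ τ) * (X * B + W.submatrix π.symm id))) :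
    mlPermutations X (observation π X B W) = {π} := by
  have hPi : P * P = P := by
    conv_lhs => rhs; rw [hPC]
    rw [← Matrix.mul_assoc, hPX, ← hPC]
  set W' := W.submatrix π.symm id with hW'
  have hres : ∀ (τ : Equiv.Perm (Fin n)) (B' : Matrix (Fin p) (Fin m) ℝ),
      frobSq ((1 - P.submatrix τ τ) * (X * B + W')) ≤
        frobSq (X * B + W' - X.submatrix τ id * B') := by
    intro τ B'
    obtain ⟨h1, h2⟩ := submatrix_symm_idem hPs hPi τ
    obtain ⟨h3, h4⟩ := one_sub_symm_idem h1 h2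
    have h5 : (1 - P.submatrix τ τ) * (X.submatrix τ id * B') = 0 := by
      rw [← Matrix.mul_assoc, Matrix.sub_mul, Matrix.submatrix_mul_equiv, hPX]
      simp
    have := frobSq_symm_idem_mul_le h3 h4 (X * B + W' - X.submatrix τ id * B')
    rwa [Matrix.mul_sub, h5, sub_zero] at this
  have h1P : (1 - P) * (X * B + W') = (1 - P) * W' := by
    rw [Matrix.mul_add, ← Matrix.mul_assoc, Matrix.sub_mul, hPX]
    simp
  have hbest : X * B + W' - X.submatrix (1 : Equiv.Perm (Fin n)) id * (C * (X * B + W')) =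
      (1 - P) * W' := by
    rw [← h1P, Matrix.sub_mul, hPC, Matrix.one_mul, Matrix.mul_assoc]
    rfl
  have hopt : ∀ (τ : Equiv.Perm (Fin n)) (B' : Matrix (Fin p) (Fin m) ℝ),
      frobSq ((1 - P) * W') ≤ frobSq (X * B + W' - X.submatrix τ id * B') := by
    intro τ B'
    refine le_trans ?_ (hres τ B')
    by_cases h : τ = 1
    · subst h
      rw [← h1P]
      exact le_of_eq (by simp)
    · exact (hsep τ h).le
  ext π'
  simp only [mlPermutations, Set.mem_ofPred_eq, Set.mem_singleton_iff]
  constructor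
  · rintro ⟨B', hB'⟩
    by_contra hne
    have hτ : π' * π⁻¹ ≠ 1 := by
      rwa [Ne, mul_inv_eq_one]
    have h1 := hB' π (C * (X * B + W'))
    rw [frobSq_observation_sub, frobSq_observation_sub, ← hW', mul_inv_cancel, hbest] at h1
    exact absurd (lt_of_lt_of_le (hsep _ hτ) (hres _ B')) (not_lt.2 h1)
  · rintro rfl
    refine ⟨C * (X * B + W'), fun π'' B' => ?_⟩
    rw [frobSq_observation_sub, frobSq_observation_sub, ← hW', mul_inv_cancel, hbest]
    exact hopt _ _

lemma abs_trace_transpose_mul_le {k l : ℕ} {A B : Matrix (Fin k) (Fin l) ℝ} {a b : ℝ}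
    (ha : frobSq A ≤ a) (hb : frobSq B ≤ b) : |(A.transpose * B).trace| ≤ Real.sqrt (a * b) :=
  Real.abs_le_sqrt <| (sq_trace_transpose_mul_le A B).trans <|
    mul_le_mul ha hb (frobSq_nonneg B) ((frobSq_nonneg A).trans ha)

/-- Separation of the residuals from a lower bound on the signal. The correlation of the
noise with the difference of two projections of equal trace only sees the fluctuation of
`W * Wᵀ` around a multiple `c` of the identity, which makes the noise term much smaller than
`‖W‖²`. -/
lemma residual_separation {n p m : ℕ} {X : Matrix (Fin n) (Fin p) ℝ}
    {B : Matrix (Fin p) (Fin m) ℝ} {W : Matrix (Fin n) (Fin m) ℝ}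
    {P : Matrix (Fin n) (Fin n) ℝ} (hPs : P.transpose = P) (hPi : P * P = P)
    (τ : Equiv.Perm (Fin n)) {a b c d : ℝ} (ha : frobSq X ≤ a)
    (hb : frobSq (W * B.transpose) ≤ b) (hd : frobSq (W * W.transpose - c • 1) ≤ d)
    (hS : 2 * Real.sqrt (n * a * b) + 2 * Real.sqrt (n * d) <
      frobSq ((1 - P.submatrix τ τ) * X * B)) :
    frobSq ((1 - P) * W) < frobSq ((1 - P.submatrix τ τ) * (X * B + W)) := by
  set P' := P.submatrix τ τ with hP'
  obtain ⟨hs', hi'⟩ := submatrix_symm_idem hPs hPi τ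
  obtain ⟨hsR, hiR⟩ := one_sub_symm_idem hPs hPi
  obtain ⟨hsR', hiR'⟩ := one_sub_symm_idem hs' hi'
  rw [← hP'] at hs' hi' hsR' hiR'
  set R := 1 - P with hR
  set R' := 1 - P' with hR'
  set G := W * W.transpose - c • (1 : Matrix (Fin n) (Fin n) ℝ) with hG
  have htr : P'.trace = P.trace := by
    simp only [hP', Matrix.trace, Matrix.diag, Matrix.submatrix_apply]
    exact Equiv.sum_comp τ fun i => P i i
  have hWW : W * W.transpose = G + c • 1 := by simp [hG]
  have hquad : ∀ {T : Matrix (Fin n) (Fin n) ℝ}, T.transpose = T → T * T = T →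
      frobSq ((1 - T) * W) = (W.transpose * W).trace - (T.transpose * G).trace - c * T.trace := by
    intro T hTs hTi
    obtain ⟨h1, h2⟩ := one_sub_symm_idem hTs hTi
    rw [frobSq_symm_idem_mul h1 h2, hTs, Matrix.mul_sub, Matrix.sub_mul, Matrix.trace_sub,
      Matrix.mul_one, Matrix.mul_assoc W.transpose T W, Matrix.trace_mul_comm W.transpose (T * W),
      Matrix.mul_assoc T, hWW, Matrix.mul_add, Matrix.trace_add]
    simp
    ring
  have hcross : ((R' * (X * B)).transpose * (R' * W)).trace =
      ((R' * X).transpose * (W * B.transpose)).trace := by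
    rw [Matrix.transpose_mul, hsR', Matrix.mul_assoc, ← Matrix.mul_assoc R', hiR',
      Matrix.transpose_mul, Matrix.transpose_mul, hsR', Matrix.mul_assoc, Matrix.trace_mul_comm]
    simp only [Matrix.mul_assoc]
  have e1 := abs_trace_transpose_mul_le (A := R' * X) (B := W * B.transpose) (a := n * a)
    ((frobSq_mul_le _ _).trans (mul_le_mul (frobSq_symm_idem_le hsR' hiR') ha (frobSq_nonneg _)
      (Nat.cast_nonneg n))) hb
  have e2 := abs_trace_transpose_mul_le (frobSq_symm_idem_le hPs hPi) hd
  have e3 := abs_trace_transpose_mul_le (frobSq_symm_idem_le hs' hi') hd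
  rw [Matrix.mul_add, frobSq_add, hcross, hquad hPs hPi, hR', hquad hs' hi', htr, ← hR',
    ← Matrix.mul_assoc]
  have := abs_le.1 e1
  have := abs_le.1 e2
  have := abs_le.1 e3
  linarith

/-- The residual of `X v` off the column space of the row-permuted `X` is the distance to some
point of that space. -/
lemma exists_residual_eq {n p : ℕ} {X : Matrix (Fin n) (Fin p) ℝ}
    {P : Matrix (Fin n) (Fin n) ℝ} {C : Matrix (Fin p) (Fin n) ℝ} (hPC : P = X * C)
    (τ : Equiv.Perm (Fin n)) (v : Fin p → ℝ) :
    ∃ u : Fin p → ℝ, ∀ i, (((1 - P.submatrix τ τ) * X).mulVec v) i =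
      (X.mulVec v) i - (X.mulVec u) (τ i) := by
  refine ⟨(C.submatrix id τ * X).mulVec v, fun i => ?_⟩
  have h : P.submatrix τ τ = X.submatrix τ id * C.submatrix id τ := by
    rw [hPC]
    ext i j
    simp [Matrix.mul_apply]
  rw [Matrix.sub_mul, Matrix.one_mul, Matrix.sub_mulVec, Pi.sub_apply, h, Matrix.mul_assoc,
    ← Matrix.mulVec_mulVec]
  rfl

/-! ### Small-ball estimates for Gaussian vectors -/

lemma gaussianReal_closedBall_le {v : ℝ≥0} (hv : v ≠ 0) (y r : ℝ) :
    gaussianReal 0 v (Metric.closedBall y r) ≤ ENNReal.ofReal (r / Real.sqrt v) := by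
  have hv0 : (0 : ℝ) < v := by positivity
  have hbound : ∀ x, gaussianPDF 0 v x ≤ ENNReal.ofReal ((Real.sqrt (2 * Real.pi * v))⁻¹) := by
    intro x
    rw [gaussianPDF_def]
    refine ENNReal.ofReal_le_ofReal ?_
    rw [gaussianPDFReal_def]
    refine mul_le_of_le_one_right (by positivity) (Real.exp_le_one_iff.2 ?_)
    exact div_nonpos_of_nonpos_of_nonneg (by nlinarith [sq_nonneg (x - 0)]) (by positivity)
  have h2 : (2 : ℝ) * Real.sqrt v ≤ Real.sqrt (2 * Real.pi * v) := by
    refine Real.le_sqrt_of_sq_le ?_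
    rw [mul_pow, Real.sq_sqrt hv0.le]
    nlinarith [Real.pi_gt_three]
  rcases lt_or_ge r 0 with hr | hr
  · rw [Metric.closedBall_eq_empty.2 hr]
    simp
  rw [gaussianReal_apply 0 hv]
  calc ∫⁻ x in Metric.closedBall y r, gaussianPDF 0 v x
      ≤ ∫⁻ _x in Metric.closedBall y r, ENNReal.ofReal ((Real.sqrt (2 * Real.pi * v))⁻¹) :=
        lintegral_mono fun x => hbound x
    _ = ENNReal.ofReal ((Real.sqrt (2 * Real.pi * v))⁻¹) * ENNReal.ofReal (2 * r) := by
        rw [lintegral_const, Measure.restrict_apply_univ, Real.volume_closedBall]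
    _ = ENNReal.ofReal ((Real.sqrt (2 * Real.pi * v))⁻¹ * (2 * r)) := by
        rw [← ENNReal.ofReal_mul (by positivity)]
    _ ≤ ENNReal.ofReal (r / Real.sqrt v) := by
        refine ENNReal.ofReal_le_ofReal ?_
        have hs : 0 < Real.sqrt v := Real.sqrt_pos.2 hv0
        rw [inv_mul_le_iff₀ (by positivity), ← mul_div_assoc, le_div_iff₀ hs]
        nlinarith

/-- Conditionally on the remaining coordinates, independent Gaussian coordinates avoid small
balls around centres that depend on those remaining coordinates only. -/
lemma measure_forall_abs_sub_le {Ω κ : Type*} [MeasurableSpace Ω] {μ : Measure Ω}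
    [IsProbabilityMeasure μ] [Fintype κ] [DecidableEq κ] {Z : κ → Ω → ℝ} (hZ : iIndepFun Z μ)
    (hZm : ∀ k, AEMeasurable (Z k) μ) (T : Finset κ) {v : ℝ≥0} (hv : v ≠ 0)
    (hlaw : ∀ t ∈ T, HasLaw (Z t) (gaussianReal 0 v) μ)
    {f : T → ((Tᶜ : Finset κ) → ℝ) → ℝ} (hf : ∀ t, Measurable (f t)) (r : ℝ) :
    μ {ω | ∀ t : T, |f t (fun s => Z s ω) - Z t ω| ≤ r} ≤
      ENNReal.ofReal (r / Real.sqrt v) ^ T.card := by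
  have hind := hZ.indepFun_finset₀ Tᶜ T disjoint_compl_left hZm
  have hAm : AEMeasurable (fun ω (s : (Tᶜ : Finset κ)) => Z s ω) μ :=
    aemeasurable_pi_lambda _ fun s => hZm s
  have hGm : AEMeasurable (fun ω (t : T) => Z t ω) μ :=
    aemeasurable_pi_lambda _ fun t => hZm t
  have hG : μ.map (fun ω (t : T) => Z t ω) = Measure.pi fun _ : T => gaussianReal 0 v := by
    have h := hZ.precomp (g := ((↑) : T → κ)) Subtype.val_injective
    rw [iIndepFun_iff_map_fun_eq_pi_map (fun t => hZm _)] at h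
    refine h.trans ?_
    congr 1
    ext1 t
    exact (hlaw t t.2).map_eq
  rw [indepFun_iff_map_prod_eq_prod_map_map hAm hGm, hG] at hind
  set E : Set (((Tᶜ : Finset κ) → ℝ) × (T → ℝ)) := {x | ∀ t : T, |f t x.1 - x.2 t| ≤ r} with hE
  have hEm : MeasurableSet E := by
    rw [hE, Set.ofPred_forall]
    refine MeasurableSet.iInter fun t => measurableSet_le ?_ measurable_const
    have h1 : Measurable fun x : ((Tᶜ : Finset κ) → ℝ) × (T → ℝ) => f t x.1 :=
      (hf t).comp measurable_fst
    have h2 : Measurable fun x : ((Tᶜ : Finset κ) → ℝ) × (T → ℝ) => x.2 t :=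
      (measurable_pi_apply t).comp measurable_snd
    exact (h1.sub h2).norm
  have hpre : μ {ω | ∀ t : T, |f t (fun s => Z s ω) - Z t ω| ≤ r} =
      μ.map (fun ω => ((fun (s : (Tᶜ : Finset κ)) => Z s ω), fun t : T => Z t ω)) E := by
    rw [Measure.map_apply_of_aemeasurable (hAm.prodMk hGm) hEm]
    rfl
  have : IsProbabilityMeasure (μ.map fun ω (s : (Tᶜ : Finset κ)) => Z s ω) :=
    Measure.isProbabilityMeasure_map hAm
  rw [hpre, hind, Measure.prod_apply hEm]
  have hsec : ∀ x, (Measure.pi fun _ : T => gaussianReal 0 v) (Prod.mk x ⁻¹' E) ≤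
      ENNReal.ofReal (r / Real.sqrt v) ^ T.card := by
    intro x
    have : Prod.mk x ⁻¹' E = Set.pi Set.univ fun t => Metric.closedBall (f t x) r := by
      ext y
      simp [hE, Real.dist_eq, abs_sub_comm]
    rw [this, Measure.pi_pi]
    calc ∏ t : T, gaussianReal 0 v (Metric.closedBall (f t x) r)
        ≤ ∏ _t : T, ENNReal.ofReal (r / Real.sqrt v) :=
          Finset.prod_le_prod' fun t _ => gaussianReal_closedBall_le hv _ _
      _ = _ := by simp
  calc _ ≤ ∫⁻ _x, ENNReal.ofReal (r / Real.sqrt v) ^ T.card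
          ∂(μ.map fun ω (s : (Tᶜ : Finset κ)) => Z s ω) := lintegral_mono hsec
    _ = _ := by simp

/-- The images of a Gaussian matrix on pairwise orthogonal vectors consist of independent
centred Gaussian variables, with variance the squared length of the vector. -/
lemma iIndepFun_mulVec_of_orthogonal {Ω κ : Type*} [MeasurableSpace Ω] {μ : Measure Ω}
    [IsProbabilityMeasure μ] [Fintype κ] {n p : ℕ} {X : Ω → Matrix (Fin n) (Fin p) ℝ}
    (hlaw : ∀ i j, HasLaw (fun ω => X ω i j) (gaussianReal 0 1) μ)
    (hind : iIndepFun (fun (k : Fin n × Fin p) ω => X ω k.1 k.2) μ) (w : κ → Fin p → ℝ)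
    (hw : ∀ s t, s ≠ t → ∑ k, w s k * w t k = 0) :
    iIndepFun (fun (x : Fin n × κ) ω => ((X ω).mulVec (w x.2)) x.1) μ ∧
      ∀ x : Fin n × κ, HasLaw (fun ω => ((X ω).mulVec (w x.2)) x.1)
        (gaussianReal 0 (∑ k, w x.2 k ^ 2).toNNReal) μ := by
  have hX : ∀ k : Fin n × Fin p, HasGaussianLaw (fun ω => X ω k.1 k.2) μ := fun k =>
    (hlaw k.1 k.2).hasGaussianLaw
  have hXjoint : HasGaussianLaw (fun ω (k : Fin n × Fin p) => X ω k.1 k.2) μ :=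
    hind.hasGaussianLaw hX
  have hmem : ∀ i j, MemLp (fun ω => X ω i j) 2 μ := fun i j => (hX (i, j)).memLp_two
  let L : (Fin n × Fin p → ℝ) →L[ℝ] (Fin n × κ → ℝ) :=
    ContinuousLinearMap.pi fun x => ∑ k, w x.2 k • ContinuousLinearMap.proj (x.1, k)
  have hLX : HasGaussianLaw (fun ω (x : Fin n × κ) => ((X ω).mulVec (w x.2)) x.1) μ := by
    convert! hXjoint.map_fun L using 2 with ω
    ext x
    simp [L, Matrix.mulVec, dotProduct, mul_comm]
  have hcovX : ∀ i j k l, cov[fun ω => X ω i j, fun ω => X ω k l; μ] =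
      if (i, j) = (k, l) then 1 else 0 := by
    intro i j k l
    split_ifs with h
    · obtain ⟨rfl, rfl⟩ := Prod.mk.inj h
      rw [covariance_self (hlaw i j).aemeasurable, (hlaw i j).variance_eq, variance_id_gaussianReal]
      simp
    · exact (hind.indepFun h).covariance_eq_zero (hmem i j) (hmem k l)
  have hcov : ∀ x y : Fin n × κ, cov[fun ω => ((X ω).mulVec (w x.2)) x.1,
      fun ω => ((X ω).mulVec (w y.2)) y.1; μ] =
      if x.1 = y.1 then ∑ k, w x.2 k * w y.2 k else 0 := by
    intro x y
    simp only [Matrix.mulVec, dotProduct]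
    rw [covariance_fun_sum_fun_sum (fun k => (hmem _ _).mul_const _)
      (fun k => (hmem _ _).mul_const _)]
    simp_rw [covariance_mul_const_left, covariance_mul_const_right, hcovX, Prod.mk.injEq]
    split_ifs with h
    · simp [h, mul_comm]
    · simp [h]
  refine ⟨hLX.iIndepFun_of_covariance_eq_zero fun x y hxy => ?_, fun x => ?_⟩
  · rw [hcov]
    split_ifs with h
    · exact hw _ _ fun h2 => hxy (Prod.ext h h2)
    · rfl
  · have hm : AEMeasurable (fun ω => ((X ω).mulVec (w x.2)) x.1) μ := (hLX.eval x).aemeasurable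
    refine ⟨hm, ?_⟩
    rw [(hLX.eval x).map_eq_gaussianReal]
    have hmean : ∫ ω, ((X ω).mulVec (w x.2)) x.1 ∂μ = 0 := by
      simp only [Matrix.mulVec, dotProduct]
      rw [integral_finsetSum _ fun k _ => ((hX (x.1, k)).integrable).mul_const _]
      refine Finset.sum_eq_zero fun k _ => ?_
      rw [integral_mul_const, (hlaw x.1 k).integral_eq]
      simp
    rw [hmean, ← covariance_self hm, hcov]
    simp [sq]

/-- Small-ball estimate for a fixed point of the parameter space: if `u` is at distance at least
`√d` from the line of `v`, then `X u` has, given `X v`, a component with independent Gaussian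
coordinates of variance at least `d`. -/
lemma measure_mulVec_close_le {Ω : Type*} [MeasurableSpace Ω] {μ : Measure Ω}
    [IsProbabilityMeasure μ] {n p : ℕ} {X : Ω → Matrix (Fin n) (Fin p) ℝ}
    (hlaw : ∀ i j, HasLaw (fun ω => X ω i j) (gaussianReal 0 1) μ)
    (hind : iIndepFun (fun (k : Fin n × Fin p) ω => X ω k.1 k.2) μ) {v u : Fin p → ℝ}
    (hv : ∑ k, v k ^ 2 = 1) {d r : ℝ} (hd : 0 < d) (hr : 0 ≤ r)
    (hu : d ≤ ∑ k, (u k - (∑ l, u l * v l) * v k) ^ 2) (τ : Equiv.Perm (Fin n)) (c : ℝ) :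
    μ {ω | ∀ i, |c * ((X ω).mulVec v) i - ((X ω).mulVec u) (τ i)| ≤ r} ≤
      ENNReal.ofReal (r / Real.sqrt d) ^ n := by
  classical
  set b := ∑ l, u l * v l with hb
  set z : Fin p → ℝ := fun k => u k - b * v k with hz
  let w : Bool → Fin p → ℝ := fun t => if t then z else v
  have horth : ∑ k, z k * v k = 0 := by
    simp only [hz, sub_mul, Finset.sum_sub_distrib, ← hb, mul_assoc, ← Finset.mul_sum, ← sq, hv]
    ring
  have hw : ∀ s t, s ≠ t → ∑ k, w s k * w t k = 0 := by
    intro s t hst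
    have horth' : ∑ k, v k * z k = 0 := by simpa only [mul_comm] using horth
    cases s <;> cases t <;> simp_all [w]
  obtain ⟨h1, h2⟩ := iIndepFun_mulVec_of_orthogonal hlaw hind w hw
  set N : ℝ≥0 := (∑ k, z k ^ 2).toNNReal with hN
  have hdN : d ≤ N := hu.trans (Real.le_coe_toNNReal _)
  have hN0 : N ≠ 0 := by
    intro h
    rw [h] at hdN
    exact absurd hdN (by simpa using hd)
  let T : Finset (Fin n × Bool) := Finset.univ.image fun i => (i, true)
  have hT : ∀ x : Fin n × Bool, x ∈ T ↔ x.2 = true := by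
    rintro ⟨i, t⟩
    simp [T, eq_comm]
  have hTc : ∀ i, (i, false) ∈ Tᶜ := fun i => by
    rw [Finset.mem_compl, hT]; simp
  have hcard : T.card = n := by
    rw [Finset.card_image_of_injective _ (fun i j h => (Prod.mk.inj h).1)]
    simp
  have key := measure_forall_abs_sub_le h1 (fun k => (h2 k).aemeasurable) T hN0
    (fun t ht => by
      have := h2 t
      rw [(hT t).1 ht] at this
      rw [(hT t).1 ht]
      simpa [w] using this)
    (f := fun t A => c * A ⟨(τ.symm t.1.1, false), hTc _⟩ - b * A ⟨(t.1.1, false), hTc _⟩)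
    (fun t => by fun_prop) r
  rw [hcard] at key
  refine (measure_mono ?_).trans (key.trans ?_)
  · intro ω hω t
    obtain ⟨⟨i, t⟩, ht⟩ := t
    obtain rfl : t = true := (hT _).1 ht
    have := hω (τ.symm i)
    rw [Equiv.apply_symm_apply] at this
    convert this using 2
    have hzu : (X ω).mulVec z = (X ω).mulVec u - b • (X ω).mulVec v := by
      rw [← Matrix.mulVec_smul, ← Matrix.mulVec_sub]
      rfl
    simp [w, hzu]
  · gcongr

/-- The entries of `X v` for a unit vector `v` are independent standard Gaussians, so that
`(X v) i ± (X v) (τ i)` is unlikely to be small for all `i` in a set that `τ` moves off itself. -/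
lemma measure_mulVec_perm_close_le {Ω : Type*} [MeasurableSpace Ω] {μ : Measure Ω}
    [IsProbabilityMeasure μ] {n p : ℕ} {X : Ω → Matrix (Fin n) (Fin p) ℝ}
    (hlaw : ∀ i j, HasLaw (fun ω => X ω i j) (gaussianReal 0 1) μ)
    (hind : iIndepFun (fun (k : Fin n × Fin p) ω => X ω k.1 k.2) μ) {v : Fin p → ℝ}
    (hv : ∑ k, v k ^ 2 = 1) (τ : Equiv.Perm (Fin n)) {S : Finset (Fin n)}
    (hS : ∀ i ∈ S, τ i ∉ S) (c r : ℝ) :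
    μ {ω | ∀ i, |c * ((X ω).mulVec v) (τ i) - ((X ω).mulVec v) i| ≤ r} ≤
      ENNReal.ofReal r ^ S.card := by
  classical
  obtain ⟨h1, h2⟩ := iIndepFun_mulVec_of_orthogonal hlaw hind (fun _ : Unit => v)
    (fun s t h => absurd rfl h)
  have h1' := h1.precomp (g := fun i : Fin n => (i, ())) fun i j h => (Prod.mk.inj h).1
  have key := measure_forall_abs_sub_le h1' (fun k => (h2 (k, ())).aemeasurable) S
    one_ne_zero (fun t _ => by simpa [hv] using h2 (t, ()))
    (f := fun t A => c * A ⟨τ t.1, Finset.mem_compl.2 (hS _ t.2)⟩)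
    (fun t => by fun_prop) r
  refine (measure_mono ?_).trans (key.trans (by simp))
  intro ω hω t
  exact hω t

/-! ### Concentration of the noise -/

section Concentration

variable {Ω : Type*} [MeasurableSpace Ω] {μ : Measure Ω} [IsProbabilityMeasure μ]

lemma measure_le_of_variance_le {Y : Ω → ℝ} (hY : MemLp Y 2 μ) {e V t : ℝ} (he : ∫ ω, Y ω ∂μ = e)
    (hV : Var[Y; μ] ≤ V) (ht : 0 < t) :
    μ {ω | t ≤ |Y ω - e|} ≤ ENNReal.ofReal (V / t ^ 2) := by
  subst he
  exact (meas_ge_le_variance_div_sq hY ht).trans (ENNReal.ofReal_le_ofReal (by gcongr))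

lemma measure_le_abs_sum_mul_le {m : ℕ} {Z : Fin m → Ω → ℝ} {s : ℝ≥0}
    (hlaw : ∀ k, HasLaw (Z k) (gaussianReal 0 s) μ)
    (hind : Pairwise fun k l => IndepFun (Z k) (Z l) μ) (b : Fin m → ℝ) {t : ℝ} (ht : 0 < t) :
    μ {ω | t ≤ |∑ k, Z k ω * b k|} ≤ ENNReal.ofReal (s * (∑ k, b k ^ 2) / t ^ 2) := by
  have hm : ∀ k, MemLp (Z k) 2 μ := fun k => (hlaw k).hasGaussianLaw.memLp_two
  have hm' : ∀ k, MemLp (fun ω => Z k ω * b k) 2 μ := fun k => (hm k).mul_const _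
  have hmean : ∫ ω, ∑ k, Z k ω * b k ∂μ = 0 := by
    rw [integral_finsetSum _ fun k _ => (hm' k).integrable one_le_two]
    refine Finset.sum_eq_zero fun k _ => ?_
    rw [integral_mul_const, (hlaw k).integral_eq]
    simp
  have hvar : Var[fun ω => ∑ k, Z k ω * b k; μ] = s * ∑ k, b k ^ 2 := by
    have h := IndepFun.variance_sum (X := fun k ω => Z k ω * b k) (s := Finset.univ)
      (fun k _ => hm' k) (fun k _ l _ hkl =>
        (hind hkl).comp (φ := fun x => x * b k) (ψ := fun x => x * b l)
          (by fun_prop) (by fun_prop))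
    have h2 : (∑ k, fun ω => Z k ω * b k) = fun ω => ∑ k, Z k ω * b k := by
      ext ω; simp
    rw [← h2, h, Finset.mul_sum]
    refine Finset.sum_congr rfl fun k _ => ?_
    rw [variance_mul_const, (hlaw k).variance_eq, variance_id_gaussianReal]
  simpa using measure_le_of_variance_le (memLp_finsetSum _ fun k _ => hm' k) hmean hvar.le ht

/-- The fourth moment of the standard Gaussian. Its value, `3`, plays no role. -/
noncomputable def gaussianFourthMoment : ℝ := ∫ x, x ^ 4 ∂gaussianReal 0 1

lemma gaussianFourthMoment_nonneg : 0 ≤ gaussianFourthMoment :=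
  integral_nonneg fun x => by positivity

lemma integrable_pow_four_gaussianReal (s : ℝ≥0) :
    Integrable (fun x : ℝ => x ^ 4) (gaussianReal 0 s) := by
  have := (memLp_id_gaussianReal (μ := 0) (v := s) 4).integrable_norm_pow (by norm_num)
  refine this.congr (Filter.Eventually.of_forall fun x => ?_)
  simp [Even.pow_abs (by decide : Even 4)]

lemma integral_pow_four_gaussianReal (σ : ℝ≥0) :
    ∫ x, x ^ 4 ∂gaussianReal 0 (σ ^ 2) = (σ : ℝ) ^ 4 * gaussianFourthMoment := by
  have h := gaussianReal_map_const_mul (μ := 0) (v := 1) (σ : ℝ)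
  have h2 : NNReal.mk ((σ : ℝ) ^ 2) (sq_nonneg _) * 1 = σ ^ 2 := by
    rw [mul_one]; rfl
  rw [mul_zero, h2] at h
  rw [← h, integral_map (by fun_prop) (by fun_prop), gaussianFourthMoment, ← integral_const_mul]
  simp only [mul_pow]

/-- Entrywise concentration of the Gram matrix of the rows of the noise. -/
lemma measure_le_abs_gram_sub_le {n m : ℕ} {W : Ω → Matrix (Fin n) (Fin m) ℝ} {σ : ℝ≥0}
    (hlaw : ∀ i j, HasLaw (fun ω => W ω i j) (gaussianReal 0 (σ ^ 2)) μ)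
    (hind : iIndepFun (fun (k : Fin n × Fin m) ω => W ω k.1 k.2) μ) (i j : Fin n) {t : ℝ}
    (ht : 0 < t) :
    μ {ω | t ≤ |(∑ k, W ω i k * W ω j k) - if i = j then m * (σ : ℝ) ^ 2 else 0|} ≤
      ENNReal.ofReal (m * ((σ : ℝ) ^ 4 * gaussianFourthMoment) / t ^ 2) := by
  have hm : ∀ i k, MemLp (fun ω => W ω i k) 2 μ := fun i k => (hlaw i k).hasGaussianLaw.memLp_two
  have h4 : ∀ i k, Integrable (fun ω => W ω i k ^ 4) μ ∧
      ∫ ω, W ω i k ^ 4 ∂μ = (σ : ℝ) ^ 4 * gaussianFourthMoment := by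
    intro i k
    have hi := integrable_pow_four_gaussianReal (σ ^ 2)
    rw [← integral_pow_four_gaussianReal, ← (hlaw i k).map_eq]
    rw [← (hlaw i k).map_eq] at hi
    have ha := (hlaw i k).aemeasurable
    have hc : Continuous fun x : ℝ => x ^ 4 := by fun_prop
    exact ⟨(integrable_map_measure hc.aestronglyMeasurable ha).1 hi,
      (integral_map ha hc.aestronglyMeasurable).symm⟩
  have hle : ∀ k ω, (W ω i k * W ω j k) ^ 2 ≤ (W ω i k ^ 4 + W ω j k ^ 4) / 2 := fun k ω => by
    nlinarith [sq_nonneg (W ω i k ^ 2 - W ω j k ^ 2)]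
  have hmeas : ∀ k, AEStronglyMeasurable (fun ω => W ω i k * W ω j k) μ := fun k =>
    (hm i k).1.mul (hm j k).1
  have hdom : ∀ k, Integrable (fun ω => (W ω i k ^ 4 + W ω j k ^ 4) / 2) μ := fun k =>
    ((h4 i k).1.add (h4 j k).1).div_const 2
  have hint : ∀ k, Integrable (fun ω => (W ω i k * W ω j k) ^ 2) μ := fun k =>
    (hdom k).mono' ((hmeas k).pow 2) (Filter.Eventually.of_forall fun ω => by
      rw [Real.norm_of_nonneg (sq_nonneg _)]
      exact hle k ω)
  have hm2 : ∀ k, MemLp (fun ω => W ω i k * W ω j k) 2 μ := fun k =>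
    (memLp_two_iff_integrable_sq (hmeas k)).2 (hint k)
  have hvar1 : ∀ k, Var[fun ω => W ω i k * W ω j k; μ] ≤ (σ : ℝ) ^ 4 * gaussianFourthMoment := by
    intro k
    refine (variance_le_expectation_sq (hmeas k)).trans ?_
    refine (integral_mono (hint k) (hdom k) (hle k)).trans ?_
    rw [integral_div, integral_add (h4 i k).1 (h4 j k).1, (h4 i k).2, (h4 j k).2]
    linarith
  have hvar : Var[fun ω => ∑ k, W ω i k * W ω j k; μ] ≤
      m * ((σ : ℝ) ^ 4 * gaussianFourthMoment) := by
    have h := IndepFun.variance_sum (X := fun k ω => W ω i k * W ω j k) (s := Finset.univ)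
      (fun k _ => hm2 k) (fun k _ l _ hkl => by
        have := hind.indepFun_prodMk_prodMk₀ (fun x => (hlaw x.1 x.2).aemeasurable)
          (i, k) (j, k) (i, l) (j, l) (by simp [hkl]) (by simp [hkl]) (by simp [hkl])
          (by simp [hkl])
        exact this.comp (φ := fun x : ℝ × ℝ => x.1 * x.2) (ψ := fun x : ℝ × ℝ => x.1 * x.2)
          (by fun_prop) (by fun_prop))
    have h2 : (∑ k, fun ω => W ω i k * W ω j k) = fun ω => ∑ k, W ω i k * W ω j k := by
      ext ω; simp
    rw [← h2, h]
    calc _ ≤ ∑ _k : Fin m, (σ : ℝ) ^ 4 * gaussianFourthMoment :=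
          Finset.sum_le_sum fun k _ => hvar1 k
      _ = _ := by simp
  have hmean : ∫ ω, ∑ k, W ω i k * W ω j k ∂μ = if i = j then m * (σ : ℝ) ^ 2 else 0 := by
    rw [integral_finsetSum _ fun k _ => (hm2 k).integrable one_le_two]
    have h0 : ∀ i k, ∫ ω, W ω i k ∂μ = 0 := fun i k => by
      rw [(hlaw i k).integral_eq]; simp
    split_ifs with h
    · subst h
      have : ∀ k, ∫ ω, W ω i k * W ω i k ∂μ = (σ : ℝ) ^ 2 := by
        intro k
        have h1 := variance_of_integral_eq_zero (hlaw i k).aemeasurable (h0 i k)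
        rw [(hlaw i k).variance_eq, variance_id_gaussianReal] at h1
        simp only [← sq]
        rw [← h1]
        simp
      simp [this]
    · refine Finset.sum_eq_zero fun k _ => ?_
      have hik : ((i, k) : Fin n × Fin m) ≠ (j, k) := by simp [h]
      have := (hind.indepFun hik).integral_fun_mul_eq_mul_integral (hm i k).1 (hm j k).1
      rw [this, h0, zero_mul]
  exact measure_le_of_variance_le (memLp_finsetSum _ fun k _ => hm2 k) hmean hvar ht

end Concentration

/-! ### Counting permutations by the size of their support -/

/-- A third of the moved points can be chosen so that the permutation moves them off the chosen
set. -/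
lemma exists_moved_off {n : ℕ} (τ : Equiv.Perm (Fin n)) :
    ∃ S : Finset (Fin n), (∀ i ∈ S, τ i ∉ S) ∧ τ.support.card ≤ 3 * S.card := by
  classical
  obtain ⟨S, hS, hmax⟩ := Finset.exists_max_image
    (Finset.univ.filter fun S : Finset (Fin n) => ∀ i ∈ S, τ i ∉ S) Finset.card
    ⟨∅, by simp⟩
  rw [Finset.mem_filter] at hS
  refine ⟨S, hS.2, ?_⟩
  have hsub : τ.support ⊆ S ∪ S.image τ ∪ S.image τ.symm := by
    intro j hj
    by_contra hout
    simp only [Finset.mem_union, Finset.mem_image, not_or, not_exists, not_and] at hout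
    obtain ⟨⟨h1, h2⟩, h3⟩ := hout
    have hτj : τ j ∉ S := fun h => h3 _ h (by simp)
    have hmem : insert j S ∈ Finset.univ.filter fun S : Finset (Fin n) => ∀ i ∈ S, τ i ∉ S := by
      rw [Finset.mem_filter]
      refine ⟨Finset.mem_univ _, fun i hi => ?_⟩
      rw [Finset.mem_insert] at hi ⊢
      rintro (h | h)
      · rcases hi with rfl | hi
        · exact (Equiv.Perm.mem_support.1 hj) h
        · exact h2 i hi h
      · rcases hi with rfl | hi
        · exact hτj h
        · exact hS.2 i hi h
    have := hmax _ hmem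
    rw [Finset.card_insert_of_notMem h1] at this
    omega
  calc τ.support.card ≤ (S ∪ S.image τ ∪ S.image τ.symm).card := Finset.card_le_card hsub
    _ ≤ (S ∪ S.image τ).card + (S.image τ.symm).card := Finset.card_union_le _ _
    _ ≤ S.card + (S.image τ).card + (S.image τ.symm).card := by
        gcongr; exact Finset.card_union_le _ _
    _ ≤ S.card + S.card + S.card :=
        add_le_add (add_le_add le_rfl Finset.card_image_le) Finset.card_image_le
    _ = 3 * S.card := by ring

/-- The generating function of the support size is dominated by the same sum over all maps
`Fin n → Fin n`, which factorizes. -/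
lemma sum_pow_card_support_le {n : ℕ} {x : ℝ} (hx : 0 ≤ x) (hnx : n * (n * x) ≤ 1) :
    ∑ τ ∈ Finset.univ.erase (1 : Equiv.Perm (Fin n)), x ^ τ.support.card ≤ 2 * (n * (n * x)) := by
  classical
  let w : Fin n → Fin n → ℝ := fun i j => if j = i then 1 else x
  have hw : ∀ i j, 0 ≤ w i j := fun i j => by dsimp only [w]; split_ifs <;> positivity
  have hterm : ∀ τ : Equiv.Perm (Fin n), x ^ τ.support.card = ∏ i, w i (τ i) := by
    intro τ
    simp only [w, Finset.prod_ite, Finset.prod_const_one, one_mul, Finset.prod_const]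
    rfl
  have hall : ∑ τ : Equiv.Perm (Fin n), x ^ τ.support.card ≤ (1 + n * x) ^ n := by
    calc ∑ τ : Equiv.Perm (Fin n), x ^ τ.support.card
        = ∑ f ∈ Finset.univ.image fun τ : Equiv.Perm (Fin n) => (τ : Fin n → Fin n),
            ∏ i, w i (f i) := by
          rw [Finset.sum_image fun _ _ _ _ h => DFunLike.coe_injective h]
          exact Finset.sum_congr rfl fun τ _ => hterm τ
      _ ≤ ∑ f : Fin n → Fin n, ∏ i, w i (f i) :=
          Finset.sum_le_sum_of_subset_of_nonneg (Finset.subset_univ _)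
            fun f _ _ => Finset.prod_nonneg fun i _ => hw _ _
      _ = ∏ i, ∑ j, w i j := (Fintype.prod_sum w).symm
      _ ≤ ∏ _i : Fin n, (1 + n * x) := by
          refine Finset.prod_le_prod (fun i _ => Finset.sum_nonneg fun j _ => hw i j) fun i _ => ?_
          calc ∑ j, w i j ≤ ∑ j, ((if j = i then 1 else 0) + x) := by
                refine Finset.sum_le_sum fun j _ => ?_
                dsimp only [w]
                split_ifs <;> linarith
            _ = 1 + n * x := by simp [Finset.sum_add_distrib]
      _ = (1 + n * x) ^ n := by simp
  have hexp : (1 + n * x) ^ n ≤ Real.exp (n * (n * x)) := by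
    rw [Real.exp_nat_mul]
    gcongr
    linarith [Real.add_one_le_exp (n * x)]
  have h0 : 0 ≤ n * (n * x) := by positivity
  have hlin := Real.abs_exp_sub_one_le (x := n * (n * x)) (by rwa [abs_of_nonneg h0])
  rw [abs_of_nonneg h0] at hlin
  have := Finset.sum_erase_add Finset.univ (fun τ : Equiv.Perm (Fin n) => x ^ τ.support.card)
    (Finset.mem_univ 1)
  simp only [Equiv.Perm.support_one, Finset.card_empty, pow_zero] at this
  linarith [le_of_abs_le hlin]

/-! ### Uniform separation of the column spaces -/

/-- The points `-1, -1 + 1/N, …, 1` of the uniform grid in `[-1, 1]`. -/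
noncomputable def gridPoint (N : ℕ) (z : Fin (2 * N + 1)) : ℝ := (z : ℝ) / N - 1

lemma exists_gridPoint_close {N : ℕ} (hN : 0 < N) {x : ℝ} (hx : |x| ≤ 1) :
    ∃ z, |x - gridPoint N z| ≤ 1 / N := by
  have hN' : (0 : ℝ) < N := Nat.cast_pos.2 hN
  obtain ⟨h1, h2⟩ := abs_le.1 hx
  have h0 : 0 ≤ (x + 1) * N := mul_nonneg (by linarith) hN'.le
  have hle : ⌊(x + 1) * N⌋₊ ≤ 2 * N := by
    refine Nat.floor_le_of_le ?_
    push_cast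
    nlinarith
  refine ⟨⟨⌊(x + 1) * N⌋₊, Nat.lt_succ_of_le hle⟩, ?_⟩
  have h3 := Nat.floor_le h0
  have h4 := Nat.lt_floor_add_one ((x + 1) * N)
  simp only [gridPoint]
  have h5 : x - ((⌊(x + 1) * N⌋₊ : ℝ) / N - 1) = ((x + 1) * N - ⌊(x + 1) * N⌋₊) / N := by
    field_simp
    ring
  rw [h5, abs_of_nonneg (div_nonneg (by linarith) hN'.le)]
  gcongr
  linarith

lemma abs_mulVec_le {n p : ℕ} {X : Matrix (Fin n) (Fin p) ℝ} {R t : ℝ} (hX : ∀ i j, |X i j| ≤ R)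
    {w : Fin p → ℝ} (hw : ∀ k, |w k| ≤ t) (i : Fin n) : |(X.mulVec w) i| ≤ p * R * t := by
  calc |∑ k, X i k * w k| ≤ ∑ k, |X i k * w k| := Finset.abs_sum_le_sum_abs _ _
    _ ≤ ∑ _k : Fin p, R * t := by
        refine Finset.sum_le_sum fun k _ => ?_
        rw [abs_mul]
        exact mul_le_mul (hX i k) (hw k) (abs_nonneg _) ((abs_nonneg _).trans (hX i k))
    _ = p * R * t := by simp [mul_assoc]

/-- A vector that is far from both its permutation and minus its permutation is quantitatively
linearly independent of its permutation. The two vectors have equal length, so `±1` are the only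
coefficients that have to be excluded. -/
lemma le_sum_sq_sub_perm {n : ℕ} (a : Fin n → ℝ) (τ : Equiv.Perm (Fin n)) {t : ℝ}
    (h1 : t ≤ ∑ i, (a i - a (τ i)) ^ 2) (h2 : t ≤ ∑ i, (a i + a (τ i)) ^ 2) (c b : ℝ) :
    (c ^ 2 + b ^ 2) * (t / 2) ≤ ∑ i, (c * a i - b * a (τ i)) ^ 2 := by
  set A := ∑ i, a i ^ 2 with hA
  set I := ∑ i, a i * a (τ i) with hI
  have hA' : ∑ i, a (τ i) ^ 2 = A := Equiv.sum_comp τ fun i => a i ^ 2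
  have hexp : ∀ c b : ℝ, ∑ i, (c * a i - b * a (τ i)) ^ 2 =
      (c ^ 2 + b ^ 2) * A - 2 * (c * b) * I := by
    intro c b
    calc ∑ i, (c * a i - b * a (τ i)) ^ 2
        = ∑ i, (c ^ 2 * a i ^ 2 + b ^ 2 * a (τ i) ^ 2 - 2 * (c * b) * (a i * a (τ i))) :=
          Finset.sum_congr rfl fun i _ => by ring
      _ = _ := by
          rw [Finset.sum_sub_distrib, Finset.sum_add_distrib, ← Finset.mul_sum, ← Finset.mul_sum,
            ← Finset.mul_sum, hA', ← hA, ← hI]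
          ring
  have e1 := hexp 1 1
  have e2 := hexp 1 (-1)
  simp only [one_mul, neg_mul, sub_neg_eq_add] at e1 e2
  rw [e1] at h1
  rw [e2] at h2
  rw [hexp]
  rcases le_total 0 (c * b) with h | h
  · nlinarith [mul_nonneg (sq_nonneg (c - b)) (by linarith : 0 ≤ A + I - t / 2),
      mul_nonneg (sq_nonneg (c + b)) (by linarith : 0 ≤ A - I - t / 2)]
  · nlinarith [mul_nonneg (sq_nonneg (c - b)) (by linarith : 0 ≤ A + I - t / 2),
      mul_nonneg (sq_nonneg (c + b)) (by linarith : 0 ≤ A - I - t / 2)]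

/-- Lower bound on the distance from `X v` to the row-permuted column space of `X`. A point of that
space close to `X v` is rescaled into the unit cube and moved to the grid; it then either has
a component off `v`, which is excluded by the grid hypothesis, or makes `X v` and its permutation
almost proportional, which is excluded by the hypothesis on the signs. -/
lemma separation_of_grid {n p : ℕ} {X : Matrix (Fin n) (Fin p) ℝ} {v : Fin p → ℝ}
    (hv : ∑ k, v k ^ 2 = 1) (τ : Equiv.Perm (Fin n)) {R r r₁ d : ℝ} {N : ℕ} (hN : 0 < N)
    (hR : 0 ≤ R) (hr : 0 < r) (hr₁ : 0 < r₁) (hX : ∀ i j, |X i j| ≤ R)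
    (hNr : 2 * (p * R * (1 / N)) ≤ r) (hNd : 1 / 2 ≤ (1 - 1 / (N : ℝ)) ^ 2 - d)
    (hcon : n * (2 * r + p * R * Real.sqrt d) ^ 2 < r₁ ^ 2 / 4)
    (hsign : ∀ s : ℝ, s = 1 ∨ s = -1 → ∃ i, r₁ < |s * (X.mulVec v) (τ i) - (X.mulVec v) i|)
    (hgrid : ∀ (z₀ : Fin (2 * N + 1)) (z : Fin p → Fin (2 * N + 1)),
      d ≤ ∑ k, (gridPoint N (z k) - (∑ l, gridPoint N (z l) * v l) * v k) ^ 2 →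
      ∃ i, 2 * r < |gridPoint N z₀ * (X.mulVec v) i - (X.mulVec fun k => gridPoint N (z k)) (τ i)|)
    (u : Fin p → ℝ) : r ^ 2 ≤ ∑ i, ((X.mulVec v) i - (X.mulVec u) (τ i)) ^ 2 := by
  by_contra! hlt
  set a := X.mulVec v with ha
  have hN' : (0 : ℝ) < N := Nat.cast_pos.2 hN
  have hv1 : ∀ k, |v k| ≤ 1 := by
    intro k
    rw [← sq_le_one_iff_abs_le_one, ← hv]
    exact Finset.single_le_sum (f := fun k => v k ^ 2) (fun _ _ => sq_nonneg _)
      (Finset.mem_univ k)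
  have hclose : ∀ i, |a i - (X.mulVec u) (τ i)| ≤ r := by
    intro i
    refine abs_le_of_sq_le_sq ?_ hr.le
    exact (Finset.single_le_sum (f := fun i => (a i - (X.mulVec u) (τ i)) ^ 2)
      (fun _ _ => sq_nonneg _) (Finset.mem_univ i)).trans hlt.le
  -- rescale into the cube, with one coordinate equal to `±1`
  obtain ⟨c, w, hc1, hw1, hcw, hclose'⟩ : ∃ (c : ℝ) (w : Fin p → ℝ), |c| ≤ 1 ∧ (∀ k, |w k| ≤ 1) ∧
      (c = 1 ∨ ∃ k, |w k| = 1) ∧ ∀ i, |c * a i - (X.mulVec w) (τ i)| ≤ r := by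
    by_cases hu : ∀ k, |u k| ≤ 1
    · exact ⟨1, u, by simp, hu, Or.inl rfl, fun i => by simpa using hclose i⟩
    · push Not at hu
      obtain ⟨k₀, hk₀⟩ := hu
      obtain ⟨k, -, hk⟩ :=
        Finset.exists_max_image Finset.univ (fun k => |u k|) ⟨k₀, Finset.mem_univ _⟩
      have hs : 1 < |u k| := hk₀.trans_le (hk k₀ (Finset.mem_univ _))
      have hs0 : 0 < |u k| := by linarith
      refine ⟨|u k|⁻¹, |u k|⁻¹ • u, ?_, fun l => ?_, Or.inr ⟨k, ?_⟩, fun i => ?_⟩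
      · rw [abs_inv, abs_abs]
        exact inv_le_one_of_one_le₀ hs.le
      · rw [Pi.smul_apply, smul_eq_mul, abs_mul, abs_inv, abs_abs, inv_mul_le_iff₀ hs0, mul_one]
        exact hk l (Finset.mem_univ _)
      · rw [Pi.smul_apply, smul_eq_mul, abs_mul, abs_inv, abs_abs, inv_mul_cancel₀ hs0.ne']
      · rw [Matrix.mulVec_smul, Pi.smul_apply, smul_eq_mul, ← mul_sub, abs_mul, abs_inv, abs_abs,
          inv_mul_le_iff₀ hs0]
        nlinarith [hclose i]
  obtain ⟨z₀, hz₀⟩ := exists_gridPoint_close hN hc1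
  choose z hz using fun k => exists_gridPoint_close hN (hw1 k)
  set c' := gridPoint N z₀ with hc'
  set w' : Fin p → ℝ := fun k => gridPoint N (z k) with hw'
  have hw'z : ∀ k, gridPoint N (z k) = w' k := fun k => rfl
  have ha_le : ∀ i, |a i| ≤ p * R * 1 := abs_mulVec_le hX hv1
  have hclose2 : ∀ i, |c' * a i - (X.mulVec w') (τ i)| ≤ 2 * r := by
    intro i
    have e1 : |(c - c') * a i| ≤ p * R * (1 / N) := by
      rw [abs_mul, mul_comm]
      exact mul_le_mul (by simpa using ha_le i) hz₀ (abs_nonneg _) (by positivity)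
    have e2 : |(X.mulVec (w - w')) (τ i)| ≤ p * R * (1 / N) := abs_mulVec_le hX hz _
    have e3 : c' * a i - (X.mulVec w') (τ i) =
        (c * a i - (X.mulVec w) (τ i)) - (c - c') * a i + (X.mulVec (w - w')) (τ i) := by
      rw [Matrix.mulVec_sub, Pi.sub_apply]
      ring
    have e4 := abs_le.1 e1
    have e5 := abs_le.1 e2
    have e6 := abs_le.1 (hclose' i)
    rw [e3, abs_le]
    constructor <;> linarith [e4.1, e4.2, e5.1, e5.2, e6.1, e6.2]
  set b := ∑ l, w' l * v l with hb
  set y : Fin p → ℝ := fun k => w' k - b * v k with hy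
  have hperp : ∑ k, y k ^ 2 < d := by
    by_contra! h
    obtain ⟨i, hi⟩ := hgrid z₀ z h
    exact absurd (hclose2 i) (not_le.2 hi)
  have hy_le : ∀ k, |y k| ≤ Real.sqrt d := fun k =>
    Real.abs_le_sqrt ((Finset.single_le_sum (f := fun k => y k ^ 2) (fun _ _ => sq_nonneg _)
      (Finset.mem_univ k)).trans hperp.le)
  have hyw : ∑ k, y k ^ 2 = ∑ k, w' k ^ 2 - b ^ 2 := by
    calc ∑ k, y k ^ 2 = ∑ k, (w' k ^ 2 - 2 * b * (w' k * v k) + b ^ 2 * v k ^ 2) :=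
          Finset.sum_congr rfl fun k _ => by simp only [hy]; ring
      _ = _ := by
          rw [Finset.sum_add_distrib, Finset.sum_sub_distrib, ← Finset.mul_sum, ← Finset.mul_sum,
            hv, ← hb]
          ring
  have hX_w' : X.mulVec w' = b • a + X.mulVec y := by
    rw [ha, ← Matrix.mulVec_smul, ← Matrix.mulVec_add]
    congr 1
    ext k
    simp [hy]
  have hprop : ∀ i, (c' * a i - b * a (τ i)) ^ 2 ≤ (2 * r + p * R * Real.sqrt d) ^ 2 := by
    intro i
    have e1 := abs_le.1 (hclose2 i)
    have e2 := abs_le.1 (abs_mulVec_le hX hy_le (τ i))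
    rw [hX_w', Pi.add_apply, Pi.smul_apply, smul_eq_mul] at e1
    exact sq_le_sq' (by linarith [e1.1, e2.1]) (by linarith [e1.2, e2.2])
  have hcb : 1 / 2 ≤ c' ^ 2 + b ^ 2 := by
    have hN1 : 1 / (N : ℝ) ≤ 1 := by
      rw [div_le_one hN']
      exact_mod_cast hN
    have hsq : ∀ x x' : ℝ, |x| = 1 → |x - x'| ≤ 1 / N → (1 - 1 / (N : ℝ)) ^ 2 ≤ x' ^ 2 := by
      intro x x' hx hxx
      rw [← sq_abs x']
      have := abs_sub_abs_le_abs_sub x x'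
      gcongr
      · linarith
    have hd0 : 0 ≤ d := (Finset.sum_nonneg fun k _ => sq_nonneg (y k)).trans hperp.le
    rcases hcw with hc | ⟨k, hk⟩
    · have := hsq c c' (by simp [hc]) hz₀
      nlinarith [sq_nonneg b]
    · have h1 := hsq (w k) (w' k) hk (hz k)
      have h2 := Finset.single_le_sum (f := fun k => w' k ^ 2) (fun _ _ => sq_nonneg _)
        (Finset.mem_univ k)
      nlinarith [sq_nonneg c']
  have hfar : ∀ s : ℝ, s = 1 ∨ s = -1 → r₁ ^ 2 ≤ ∑ i, (a i - s * a (τ i)) ^ 2 := by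
    intro s hs
    obtain ⟨i, hi⟩ := hsign s hs
    calc r₁ ^ 2 ≤ |s * a (τ i) - a i| ^ 2 := by gcongr
      _ = (a i - s * a (τ i)) ^ 2 := by rw [sq_abs]; ring
      _ ≤ _ := Finset.single_le_sum (f := fun i => (a i - s * a (τ i)) ^ 2)
        (fun _ _ => sq_nonneg _) (Finset.mem_univ i)
  have hlow := le_sum_sq_sub_perm a τ (by simpa using hfar 1 (Or.inl rfl))
    (by simpa using hfar (-1) (Or.inr rfl)) c' b
  have hup : ∑ i, (c' * a i - b * a (τ i)) ^ 2 ≤ n * (2 * r + p * R * Real.sqrt d) ^ 2 := by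
    calc _ ≤ ∑ _i : Fin n, (2 * r + p * R * Real.sqrt d) ^ 2 :=
          Finset.sum_le_sum fun i _ => hprop i
      _ = _ := by simp
  nlinarith [sq_nonneg r₁]

section Separation

variable {Ω : Type*} [MeasurableSpace Ω] {μ : Measure Ω} [IsProbabilityMeasure μ] {n p : ℕ}
  {X : Ω → Matrix (Fin n) (Fin p) ℝ}

/-- Union bound over all permutations: `X v` is far from plus or minus any of its nontrivial
permutations. The estimate for `τ` decays geometrically in the size of the support of `τ`, which
compensates the number of permutations with that support size. -/
lemma measure_exists_perm_close_le
    (hlaw : ∀ i j, HasLaw (fun ω => X ω i j) (gaussianReal 0 1) μ)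
    (hind : iIndepFun (fun (k : Fin n × Fin p) ω => X ω k.1 k.2) μ) {v : Fin p → ℝ}
    (hv : ∑ k, v k ^ 2 = 1) {x : ℝ} (hx0 : 0 ≤ x) (hx1 : x ≤ 1) (hnx : n * (n * x) ≤ 1) :
    μ {ω | ∃ τ : Equiv.Perm (Fin n), τ ≠ 1 ∧ ∃ s : ℝ, (s = 1 ∨ s = -1) ∧
      ∀ i, |s * ((X ω).mulVec v) (τ i) - ((X ω).mulVec v) i| ≤ x ^ 3} ≤
      ENNReal.ofReal (4 * (n * (n * x))) := by
  classical
  let A : Equiv.Perm (Fin n) → ℝ → Set Ω := fun τ s =>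
    {ω | ∀ i, |s * ((X ω).mulVec v) (τ i) - ((X ω).mulVec v) i| ≤ x ^ 3}
  have hA : ∀ τ s, μ (A τ s) ≤ ENNReal.ofReal (x ^ τ.support.card) := by
    intro τ s
    obtain ⟨S, hS, hcard⟩ := exists_moved_off τ
    -- the cube makes up for the factor `3` between the support and the set `S`
    refine (measure_mulVec_perm_close_le hlaw hind hv τ hS s (x ^ 3)).trans ?_
    rw [← ENNReal.ofReal_pow (by positivity), ← pow_mul]
    exact ENNReal.ofReal_le_ofReal (pow_le_pow_of_le_one hx0 hx1 hcard)
  calc _ ≤ μ (⋃ τ ∈ Finset.univ.erase (1 : Equiv.Perm (Fin n)), (A τ 1 ∪ A τ (-1))) := by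
        refine measure_mono ?_
        rintro ω ⟨τ, hτ, s, hs, h⟩
        refine Set.mem_biUnion (x := τ) (by simpa using hτ) ?_
        rcases hs with rfl | rfl
        · exact Or.inl h
        · exact Or.inr h
    _ ≤ ∑ τ ∈ Finset.univ.erase (1 : Equiv.Perm (Fin n)), μ (A τ 1 ∪ A τ (-1)) :=
        measure_biUnion_finset_le _ _
    _ ≤ ∑ τ ∈ Finset.univ.erase (1 : Equiv.Perm (Fin n)),
          ENNReal.ofReal (2 * x ^ τ.support.card) := by
        refine Finset.sum_le_sum fun τ _ => (measure_union_le _ _).trans ?_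
        rw [two_mul, ENNReal.ofReal_add (by positivity) (by positivity)]
        exact add_le_add (hA τ 1) (hA τ (-1))
    _ = ENNReal.ofReal (∑ τ ∈ Finset.univ.erase (1 : Equiv.Perm (Fin n)),
          2 * x ^ τ.support.card) :=
        (ENNReal.ofReal_sum_of_nonneg fun τ _ => by positivity).symm
    _ ≤ _ := by
        refine ENNReal.ofReal_le_ofReal ?_
        rw [← Finset.mul_sum]
        linarith [sum_pow_card_support_le hx0 hnx]

/-- Union bound over all permutations and all grid points off the line of `v`. -/
lemma measure_exists_grid_close_le
    (hlaw : ∀ i j, HasLaw (fun ω => X ω i j) (gaussianReal 0 1) μ)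
    (hind : iIndepFun (fun (k : Fin n × Fin p) ω => X ω k.1 k.2) μ) {v : Fin p → ℝ}
    (hv : ∑ k, v k ^ 2 = 1) (N : ℕ) {d r : ℝ} (hd : 0 < d) (hr : 0 ≤ r) :
    μ {ω | ∃ (τ : Equiv.Perm (Fin n)) (z₀ : Fin (2 * N + 1)) (z : Fin p → Fin (2 * N + 1)),
      d ≤ ∑ k, (gridPoint N (z k) - (∑ l, gridPoint N (z l) * v l) * v k) ^ 2 ∧
      ∀ i, |gridPoint N z₀ * ((X ω).mulVec v) i -
        ((X ω).mulVec fun k => gridPoint N (z k)) (τ i)| ≤ r} ≤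
      ENNReal.ofReal ((n : ℝ) ^ n * (2 * N + 1) ^ (p + 1) * (r / Real.sqrt d) ^ n) := by
  classical
  let A : Equiv.Perm (Fin n) × Fin (2 * N + 1) × (Fin p → Fin (2 * N + 1)) → Set Ω := fun x =>
    {ω | d ≤ ∑ k, (gridPoint N (x.2.2 k) - (∑ l, gridPoint N (x.2.2 l) * v l) * v k) ^ 2 ∧
      ∀ i, |gridPoint N x.2.1 * ((X ω).mulVec v) i -
        ((X ω).mulVec fun k => gridPoint N (x.2.2 k)) (x.1 i)| ≤ r}
  have hA : ∀ x, μ (A x) ≤ ENNReal.ofReal ((r / Real.sqrt d) ^ n) := by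
    intro x
    by_cases h : d ≤ ∑ k, (gridPoint N (x.2.2 k) - (∑ l, gridPoint N (x.2.2 l) * v l) * v k) ^ 2
    · rw [ENNReal.ofReal_pow (by positivity)]
      exact (measure_mono fun ω hω => hω.2).trans
        (measure_mulVec_close_le hlaw hind hv hd hr h x.1 _)
    · have : A x = ∅ := Set.eq_empty_of_forall_notMem fun ω hω => h hω.1
      simp [this]
  calc _ ≤ μ (⋃ x, A x) := by
        refine measure_mono ?_
        rintro ω ⟨τ, z₀, z, h⟩
        exact Set.mem_iUnion.2 ⟨(τ, z₀, z), h⟩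
    _ ≤ ∑ x, μ (A x) := by
        simpa using measure_biUnion_finset_le (μ := μ) Finset.univ A
    _ ≤ ∑ _x : Equiv.Perm (Fin n) × Fin (2 * N + 1) × (Fin p → Fin (2 * N + 1)),
          ENNReal.ofReal ((r / Real.sqrt d) ^ n) := Finset.sum_le_sum fun x _ => hA x
    _ = ENNReal.ofReal (((n.factorial * (2 * N + 1) ^ (p + 1) : ℕ) : ℝ) *
          (r / Real.sqrt d) ^ n) := by
        rw [ENNReal.ofReal_mul (by positivity), ENNReal.ofReal_natCast]
        simp [Fintype.card_perm, pow_succ', mul_assoc]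
    _ ≤ _ := by
        refine ENNReal.ofReal_le_ofReal ?_
        push_cast
        gcongr
        exact_mod_cast Nat.factorial_le_pow n

/-- With high probability, `X v` stays at distance `q⁻⁷²` from all the row-permuted column
spaces of a design matrix `X` with entries bounded by `q²`. -/
lemma measure_not_separated_le
    (hlaw : ∀ i j, HasLaw (fun ω => X ω i j) (gaussianReal 0 1) μ)
    (hind : iIndepFun (fun (k : Fin n × Fin p) ω => X ω k.1 k.2) μ) {v : Fin p → ℝ}
    (hv : ∑ k, v k ^ 2 = 1) {q : ℕ} (hn : 4 ≤ n) (hp : 2 * p ≤ n) (hq : n ≤ q) :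
    μ {ω | (∀ i j, |X ω i j| ≤ (q : ℝ) ^ 2) ∧ ∃ τ : Equiv.Perm (Fin n), τ ≠ 1 ∧
      ∃ u : Fin p → ℝ,
        ∑ i, (((X ω).mulVec v) i - ((X ω).mulVec u) (τ i)) ^ 2 < ((q : ℝ)⁻¹ ^ 72) ^ 2} ≤
      ENNReal.ofReal (5 * (n / q)) := by
  have hq4 : (4 : ℝ) ≤ q := by exact_mod_cast hn.trans hq
  have hq0 : (0 : ℝ) < q := by linarith
  have hnq : (n : ℝ) ≤ q := by exact_mod_cast hq
  have hpq : (p : ℝ) ≤ q := by exact_mod_cast (by omega : p ≤ q)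
  set y : ℝ := (q : ℝ)⁻¹ with hy
  have hqy : (q : ℝ) * y = 1 := mul_inv_cancel₀ hq0.ne'
  have hy0 : 0 < y := by positivity
  have hy4 : y ≤ 1 / 4 := by
    rw [hy, inv_le_comm₀ hq0 (by norm_num)]
    linarith
  have hy1 : y ≤ 1 := by linarith
  have hqpow : ∀ a b : ℕ, (q : ℝ) ^ a * y ^ (a + b) = y ^ b := fun a b => by
    rw [pow_add, ← mul_assoc, ← mul_pow, hqy, one_pow, one_mul]
  have hsqrt : Real.sqrt (y ^ 22) = y ^ 11 := by
    rw [show y ^ 22 = (y ^ 11) ^ 2 by ring, Real.sqrt_sq (by positivity)]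
  -- With `√d = y ^ 11`, a component of `u` off `v` that is shorter than `√d` moves `X u` by at most
  -- `y ^ 8`, well below the distance `(y ^ 2) ^ 3` guaranteed by `h1`. The grid mesh `y ^ 76` moves
  -- `X u` by less than the radius `y ^ 72`.
  have h1 := measure_exists_perm_close_le hlaw hind hv (x := y ^ 2) (by positivity)
    (pow_le_one₀ hy0.le hy1) (by
      calc (n : ℝ) * (n * y ^ 2) ≤ q * (q * y ^ 2) := by gcongr
        _ = (q * y) * (q * y) := by ring
        _ ≤ 1 := by rw [hqy]; norm_num)
  have h2 := measure_exists_grid_close_le hlaw hind hv (q ^ 76) (d := y ^ 22) (r := 2 * y ^ 72)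
    (by positivity) (by positivity)
  have hp1 : (n : ℝ) * (n * y ^ 2) ≤ n / q := by
    calc (n : ℝ) * (n * y ^ 2) ≤ n * (q * y ^ 2) := by gcongr
      _ = n * y * (q * y) := by ring
      _ = n / q := by rw [hqy, hy, mul_one, div_eq_mul_inv]
  have hp2 : (n : ℝ) ^ n * (2 * ((q ^ 76 : ℕ) : ℝ) + 1) ^ (p + 1) *
      (2 * y ^ 72 / Real.sqrt (y ^ 22)) ^ n ≤ n / q := by
    have e1 : 2 * y ^ 72 / Real.sqrt (y ^ 22) ≤ y ^ 60 := by
      rw [hsqrt, div_le_iff₀ (by positivity)]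
      calc 2 * y ^ 72 = (2 * y) * y ^ 71 := by ring
        _ ≤ 1 * y ^ 71 := by gcongr; linarith
        _ = y ^ 60 * y ^ 11 := by ring
    have e2 : 2 * ((q ^ 76 : ℕ) : ℝ) + 1 ≤ (q : ℝ) ^ 77 := by
      push_cast
      have : (1 : ℝ) ≤ (q : ℝ) ^ 76 := one_le_pow₀ (by linarith)
      rw [pow_succ]
      nlinarith
    -- `p + 1 ≤ 3 n / 4`, so the count of permutations and grid points uses fewer than `59 n` powers
    have hexp : n + 77 * (p + 1) + 1 ≤ 60 * n := by omega
    calc (n : ℝ) ^ n * (2 * ((q ^ 76 : ℕ) : ℝ) + 1) ^ (p + 1) *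
          (2 * y ^ 72 / Real.sqrt (y ^ 22)) ^ n
        ≤ (q : ℝ) ^ n * ((q : ℝ) ^ 77) ^ (p + 1) * (y ^ 60) ^ n := by gcongr
      _ = (q : ℝ) ^ (n + 77 * (p + 1)) * y ^ (60 * n) := by
          rw [pow_add (q : ℝ) n, pow_mul, pow_mul]
      _ ≤ (q : ℝ) ^ (n + 77 * (p + 1)) * y ^ (n + 77 * (p + 1) + 1) :=
          mul_le_mul_of_nonneg_left (pow_le_pow_of_le_one hy0.le hy1 hexp) (by positivity)
      _ = y := by rw [hqpow, pow_one]
      _ ≤ n * y := le_mul_of_one_le_left hy0.le (by exact_mod_cast (by omega : 1 ≤ n))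
      _ = n / q := by rw [hy, div_eq_mul_inv]
  have hnn : (0 : ℝ) ≤ n / q := by positivity
  refine (measure_mono ?_).trans ((measure_union_le _ _).trans ((add_le_add
    (h1.trans (ENNReal.ofReal_le_ofReal (q := 4 * ((n : ℝ) / q)) (by linarith)))
    (h2.trans (ENNReal.ofReal_le_ofReal hp2))).trans ?_))
  · rintro ω ⟨hX, τ, hτ, u, hu⟩
    by_contra hout
    simp only [Set.mem_union, Set.mem_ofPred_eq, not_or, not_exists, not_and, not_forall,
      not_le] at hout
    refine absurd hu (not_lt.2 ?_)
    refine separation_of_grid hv τ (R := (q : ℝ) ^ 2) (r := y ^ 72) (r₁ := (y ^ 2) ^ 3)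
      (d := y ^ 22) (N := q ^ 76) (pow_pos (by omega) _) (by positivity) (by positivity)
      (by positivity) hX ?_ ?_ ?_ (hout.1 τ hτ) (hout.2 τ) u
    · have hN : (1 : ℝ) / ((q ^ 76 : ℕ) : ℝ) = y ^ 76 := by
        push_cast
        rw [hy, inv_pow, one_div]
      rw [hN]
      calc 2 * ((p : ℝ) * (q : ℝ) ^ 2 * y ^ 76) ≤ 2 * (q * (q : ℝ) ^ 2 * y ^ 76) := by gcongr
        _ = 2 * ((q : ℝ) ^ 3 * y ^ (3 + 73)) := by ring
        _ = (2 * y) * y ^ 72 := by rw [hqpow]; ring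
        _ ≤ 1 * y ^ 72 := by gcongr; linarith
        _ = y ^ 72 := one_mul _
    · have hN : (1 : ℝ) / ((q ^ 76 : ℕ) : ℝ) = y ^ 76 := by
        push_cast
        rw [hy, inv_pow, one_div]
      rw [hN]
      have e1 : y ^ 76 ≤ y ^ 2 := pow_le_pow_of_le_one hy0.le hy1 (by norm_num)
      have e2 : y ^ 22 ≤ y ^ 2 := pow_le_pow_of_le_one hy0.le hy1 (by norm_num)
      have e3 : y ^ 2 ≤ 1 / 16 := by nlinarith
      have e4 : (15 / 16 : ℝ) ≤ 1 - y ^ 76 := by linarith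
      nlinarith
    · rw [hsqrt]
      have e1 : 2 * y ^ 72 + p * (q : ℝ) ^ 2 * y ^ 11 ≤ 2 * y ^ 8 := by
        have f1 : 2 * y ^ 72 ≤ y ^ 8 := by
          calc 2 * y ^ 72 = (2 * y) * y ^ 71 := by ring
            _ ≤ 1 * y ^ 8 := mul_le_mul (by linarith)
              (pow_le_pow_of_le_one hy0.le hy1 (by norm_num)) (by positivity) (by norm_num)
            _ = y ^ 8 := one_mul _
        have f2 : p * (q : ℝ) ^ 2 * y ^ 11 ≤ y ^ 8 := by
          calc p * (q : ℝ) ^ 2 * y ^ 11 ≤ q * (q : ℝ) ^ 2 * y ^ 11 := by gcongr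
            _ = (q : ℝ) ^ 3 * y ^ (3 + 8) := by ring
            _ = y ^ 8 := hqpow _ _
        linarith
      calc (n : ℝ) * (2 * y ^ 72 + p * (q : ℝ) ^ 2 * y ^ 11) ^ 2 ≤ q * (2 * y ^ 8) ^ 2 := by gcongr
        _ = 4 * ((q : ℝ) ^ 1 * y ^ (1 + 15)) := by ring
        _ = (4 * y ^ 3) * y ^ 12 := by rw [hqpow]; ring
        _ < (1 / 4) * y ^ 12 := by
            gcongr
            calc 4 * y ^ 3 ≤ 4 * (1 / 4) ^ 3 := by gcongr
              _ < 1 / 4 := by norm_num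
        _ = ((y ^ 2) ^ 3) ^ 2 / 4 := by ring
  · rw [← ENNReal.ofReal_add (by positivity) hnn]
    exact ENNReal.ofReal_le_ofReal (by linarith)

end Separation

/-! ### Exact recovery -/

/-- Deterministic recovery on the event where all the random quantities have their typical size.
The signal outweighs the noise by a power of `q`. -/
lemma mlPermutations_eq_singleton_of_bounds {n p m q : ℕ} {σ : ℝ≥0} (hσ : 0 < σ) (hn : 4 ≤ n)
    (hp : 2 * p ≤ n) (hq : n ≤ q) {X : Matrix (Fin n) (Fin p) ℝ} {B : Matrix (Fin p) (Fin m) ℝ}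
    {W : Matrix (Fin n) (Fin m) ℝ} {π : Equiv.Perm (Fin n)} {v : Fin p → ℝ}
    (hFσ : (m : ℝ) * (σ : ℝ) ^ 2 ≤ frobSq B) (hF : ((q : ℝ) ^ 155 * σ) ^ 2 ≤ frobSq B)
    (hdir : ∀ M : Matrix (Fin n) (Fin p) ℝ,
      frobSq B * ∑ i, (M.mulVec v) i ^ 2 ≤ p * frobSq (M * B))
    (hX : ∀ i j, |X i j| ≤ (q : ℝ) ^ 2)
    (hWB : ∀ i j, |∑ k, W i k * B j k| ≤ (q : ℝ) ^ 2 * (σ * Real.sqrt (frobSq B)))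
    (hWW : ∀ i j, |(∑ k, W i k * W j k) - if i = j then m * (σ : ℝ) ^ 2 else 0| ≤
      (q : ℝ) ^ 2 * (Real.sqrt m * (σ : ℝ) ^ 2))
    (hsep : ∀ τ : Equiv.Perm (Fin n), τ ≠ 1 → ∀ u : Fin p → ℝ,
      ((q : ℝ)⁻¹ ^ 72) ^ 2 ≤ ∑ i, ((X.mulVec v) i - (X.mulVec u) (τ i)) ^ 2) :
    mlPermutations X (observation π X B W) = {π} := by
  obtain ⟨P, C, hPC, hPs, hPX⟩ := exists_projection X
  have hPi : P * P = P := by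
    conv_lhs => rhs; rw [hPC]
    rw [← Matrix.mul_assoc, hPX, ← hPC]
  refine mlPermutations_eq_singleton hPC hPs hPX fun τ hτ => ?_
  have hσ0 : (0 : ℝ) < σ := hσ
  have hq4 : (4 : ℝ) ≤ q := by exact_mod_cast hn.trans hq
  have hq0 : (0 : ℝ) < q := by linarith
  have hnq : (n : ℝ) ≤ q := by exact_mod_cast hq
  have hpq : (p : ℝ) ≤ q := by exact_mod_cast (by omega : p ≤ q)
  set F := frobSq B with hFdef
  set f := Real.sqrt F with hf
  set s := Real.sqrt (m : ℝ) with hs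
  have hF0 : 0 < F := lt_of_lt_of_le (by positivity) hF
  have hff : f ^ 2 = F := Real.sq_sqrt hF0.le
  have hss : s ^ 2 = m := Real.sq_sqrt (Nat.cast_nonneg m)
  have hf0 : 0 < f := Real.sqrt_pos.2 hF0
  have hs0 : 0 ≤ s := Real.sqrt_nonneg _
  have hfσ : (q : ℝ) ^ 155 * σ ≤ f := Real.le_sqrt_of_sq_le hF
  have hfs : s * σ ≤ f := Real.le_sqrt_of_sq_le (by rw [mul_pow, hss]; exact hFσ)
  have ha : frobSq X ≤ (q : ℝ) ^ 6 := by
    calc frobSq X ≤ n * p * ((q : ℝ) ^ 2) ^ 2 := frobSq_le_of_abs_le hX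
      _ ≤ q * q * ((q : ℝ) ^ 2) ^ 2 := by gcongr
      _ = (q : ℝ) ^ 6 := by ring
  have hb : frobSq (W.submatrix π.symm id * B.transpose) ≤ (q : ℝ) ^ 6 * (σ * f) ^ 2 := by
    calc _ ≤ n * p * ((q : ℝ) ^ 2 * (σ * f)) ^ 2 := frobSq_le_of_abs_le fun i j => by
          simpa [Matrix.mul_apply] using hWB (π.symm i) j
      _ ≤ q * q * ((q : ℝ) ^ 2 * (σ * f)) ^ 2 := by gcongr
      _ = _ := by ring
  have hd : frobSq (W.submatrix π.symm id * (W.submatrix π.symm id).transpose -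
      ((m : ℝ) * (σ : ℝ) ^ 2) • 1) ≤ (q : ℝ) ^ 6 * (s * (σ : ℝ) ^ 2) ^ 2 := by
    calc _ ≤ n * n * ((q : ℝ) ^ 2 * (s * (σ : ℝ) ^ 2)) ^ 2 := frobSq_le_of_abs_le fun i j => by
          simpa [Matrix.mul_apply, Matrix.one_apply] using hWW (π.symm i) (π.symm j)
      _ ≤ q * q * ((q : ℝ) ^ 2 * (s * (σ : ℝ) ^ 2)) ^ 2 := by gcongr
      _ = _ := by ring
  refine residual_separation hPs hPi τ ha hb hd ?_
  have h1 : Real.sqrt (n * (q : ℝ) ^ 6 * ((q : ℝ) ^ 6 * (σ * f) ^ 2)) ≤ (q : ℝ) ^ 7 * (σ * f) := by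
    refine Real.sqrt_le_iff.2 ⟨by positivity, ?_⟩
    calc n * (q : ℝ) ^ 6 * ((q : ℝ) ^ 6 * (σ * f) ^ 2)
        ≤ (q * q) * (q : ℝ) ^ 6 * ((q : ℝ) ^ 6 * (σ * f) ^ 2) := by gcongr; nlinarith
      _ = _ := by ring
  have h2 : Real.sqrt (n * ((q : ℝ) ^ 6 * (s * (σ : ℝ) ^ 2) ^ 2)) ≤
      (q : ℝ) ^ 4 * (s * (σ : ℝ) ^ 2) := by
    refine Real.sqrt_le_iff.2 ⟨by positivity, ?_⟩
    calc n * ((q : ℝ) ^ 6 * (s * (σ : ℝ) ^ 2) ^ 2)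
        ≤ (q * q) * ((q : ℝ) ^ 6 * (s * (σ : ℝ) ^ 2) ^ 2) := by gcongr; nlinarith
      _ = _ := by ring
  have h3 : (q : ℝ) ^ 4 * (s * (σ : ℝ) ^ 2) ≤ (q : ℝ) ^ 7 * (σ * f) := by
    calc (q : ℝ) ^ 4 * (s * (σ : ℝ) ^ 2) = (q : ℝ) ^ 4 * (σ * (s * σ)) := by ring
      _ ≤ (q : ℝ) ^ 7 * (σ * f) := by
          gcongr
          · linarith
          · norm_num
  obtain ⟨u, hu⟩ := exists_residual_eq hPC τ v
  have hS : F * ((q : ℝ)⁻¹ ^ 72) ^ 2 ≤ q * frobSq ((1 - P.submatrix τ τ) * X * B) := by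
    calc F * ((q : ℝ)⁻¹ ^ 72) ^ 2
        ≤ F * ∑ i, (((1 - P.submatrix τ τ) * X).mulVec v) i ^ 2 := by
          gcongr
          simp_rw [hu]
          exact hsep τ hτ u
      _ ≤ p * frobSq ((1 - P.submatrix τ τ) * X * B) := hdir _
      _ ≤ q * frobSq ((1 - P.submatrix τ τ) * X * B) := by
          gcongr
          exact frobSq_nonneg _
  have hS' : (q : ℝ) ^ 10 * (σ * f) ≤ frobSq ((1 - P.submatrix τ τ) * X * B) := by
    refine le_of_mul_le_mul_left ?_ hq0
    refine le_trans ?_ hS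
    rw [← hff]
    have h155 : (q : ℝ) ^ 155 * ((q : ℝ)⁻¹ ^ 72) ^ 2 = (q : ℝ) ^ 11 := by
      rw [← pow_mul, show 155 = 11 + 72 * 2 by norm_num, pow_add, mul_assoc, ← mul_pow,
        mul_inv_cancel₀ hq0.ne', one_pow, mul_one]
    calc (q : ℝ) * ((q : ℝ) ^ 10 * (σ * f)) = (q : ℝ) ^ 11 * (σ * f) := by ring
      _ = ((q : ℝ) ^ 155 * σ) * f * ((q : ℝ)⁻¹ ^ 72) ^ 2 := by rw [← h155]; ring
      _ ≤ f * f * ((q : ℝ)⁻¹ ^ 72) ^ 2 := by gcongr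
      _ = f ^ 2 * ((q : ℝ)⁻¹ ^ 72) ^ 2 := by ring
  have hq10 : (q : ℝ) ^ 10 * (σ * f) = (q : ℝ) ^ 3 * ((q : ℝ) ^ 7 * (σ * f)) := by ring
  have hq3 : (64 : ℝ) ≤ (q : ℝ) ^ 3 := by
    calc (64 : ℝ) = 4 ^ 3 := by norm_num
      _ ≤ (q : ℝ) ^ 3 := by gcongr
  have hpos : 0 < (q : ℝ) ^ 7 * (σ * f) := by positivity
  have h64 := mul_le_mul_of_nonneg_right hq3 hpos.le
  linarith

lemma measure_exists_exists_le {Ω : Type*} [MeasurableSpace Ω] {μ : Measure Ω} {n l q : ℕ}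
    (hq : 0 < q) (hl : l ≤ q) {A : Fin n → Fin l → Set Ω} {c : ℝ} (hc : 0 ≤ c)
    (h : ∀ i j, μ (A i j) ≤ ENNReal.ofReal (c / (q : ℝ) ^ 4)) :
    μ {ω | ∃ i j, ω ∈ A i j} ≤ ENNReal.ofReal (c * (n / q)) := by
  have hq1 : (1 : ℝ) ≤ q := by exact_mod_cast hq
  have hlq : (l : ℝ) ≤ q := by exact_mod_cast hl
  calc _ ≤ μ (⋃ x ∈ (Finset.univ : Finset (Fin n × Fin l)), A x.1 x.2) := by
        refine measure_mono ?_
        rintro ω ⟨i, j, hω⟩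
        exact Set.mem_biUnion (x := (i, j)) (by simp) hω
    _ ≤ ∑ x : Fin n × Fin l, μ (A x.1 x.2) := measure_biUnion_finset_le _ _
    _ ≤ ∑ _x : Fin n × Fin l, ENNReal.ofReal (c / (q : ℝ) ^ 4) :=
        Finset.sum_le_sum fun x _ => h _ _
    _ = ENNReal.ofReal ((n * l : ℕ) * (c / (q : ℝ) ^ 4)) := by
        rw [ENNReal.ofReal_mul (by positivity), ENNReal.ofReal_natCast]
        simp
    _ ≤ _ := by
        refine ENNReal.ofReal_le_ofReal ?_
        push_cast
        calc (n : ℝ) * l * (c / (q : ℝ) ^ 4) ≤ n * (q : ℝ) ^ 3 * (c / (q : ℝ) ^ 4) := by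
              gcongr
              exact hlq.trans (le_self_pow₀ hq1 (by norm_num))
          _ = c * (n / q) := by
              have : (q : ℝ) ≠ 0 := by positivity
              field_simp

/-- Recovery with failure probability of order `n / q`, for any scale `q ≥ n` of which a fixed
power is dominated by the total signal energy. -/
lemma measure_mlPermutations_ne_le {Ω : Type*} [MeasurableSpace Ω] {μ : Measure Ω}
    [IsProbabilityMeasure μ] {n p m q : ℕ} {σ : ℝ≥0} (hσ : 0 < σ) (hm : 0 < m) (hn : 4 ≤ n)
    (hp : 2 * p ≤ n) (hq : n ≤ q) {X : Ω → Matrix (Fin n) (Fin p) ℝ}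
    {W : Ω → Matrix (Fin n) (Fin m) ℝ} (h : IsGaussianDesign μ X W σ)
    {B : Matrix (Fin p) (Fin m) ℝ} (π : Equiv.Perm (Fin n))
    (hFσ : (m : ℝ) * (σ : ℝ) ^ 2 ≤ frobSq B) (hF : ((q : ℝ) ^ 155 * σ) ^ 2 ≤ frobSq B) :
    μ {ω | mlPermutations (X ω) (observation π (X ω) B (W ω)) ≠ {π}} ≤
      ENNReal.ofReal ((7 + gaussianFourthMoment) * (n / q)) := by
  have hq0 : 0 < q := by omega
  have hq0' : (0 : ℝ) < q := Nat.cast_pos.2 hq0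
  have hσ0 : (0 : ℝ) < σ := hσ
  have hm0 : (0 : ℝ) < m := Nat.cast_pos.2 hm
  have hF0 : 0 < frobSq B := lt_of_lt_of_le (by positivity) hF
  have hindX : iIndepFun (fun (k : Fin n × Fin p) ω => X ω k.1 k.2) μ :=
    h.indep.precomp (g := Sum.inl) Sum.inl_injective
  have hindW : iIndepFun (fun (k : Fin n × Fin m) ω => W ω k.1 k.2) μ :=
    h.indep.precomp (g := Sum.inr) Sum.inr_injective
  obtain ⟨v, hv, hdir⟩ := exists_unit_direction hF0 n
  have hC := gaussianFourthMoment_nonneg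
  have b1 : μ {ω | ∃ (i : Fin n) (j : Fin p), ω ∈ {ω | (q : ℝ) ^ 2 ≤ |X ω i j|}} ≤
      ENNReal.ofReal (1 * (n / q)) := by
    refine measure_exists_exists_le hq0 (by omega) zero_le_one fun i j => ?_
    -- a single entry is a linear combination with one term
    have := measure_le_abs_sum_mul_le (Z := fun (_ : Fin 1) ω => X ω i j)
      (fun _ => h.law_X i j) (fun k l hkl => absurd (Subsingleton.elim k l) hkl) (fun _ => 1)
      (t := (q : ℝ) ^ 2) (by positivity)
    simpa [← pow_mul] using this
  have b2 : μ {ω | ∃ (i : Fin n) (j : Fin p),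
      ω ∈ {ω | (q : ℝ) ^ 2 * (σ * Real.sqrt (frobSq B)) ≤ |∑ k, W ω i k * B j k|}} ≤
      ENNReal.ofReal (1 * (n / q)) := by
    refine measure_exists_exists_le hq0 (by omega) zero_le_one fun i j => ?_
    refine (measure_le_abs_sum_mul_le (Z := fun k ω => W ω i k) (fun k => h.law_W i k)
      (fun k l hkl => hindW.indepFun (i := (i, k)) (j := (i, l)) (by simp [hkl])) (B j)
      (by positivity)).trans (ENNReal.ofReal_le_ofReal ?_)
    have hrow : ∑ k, B j k ^ 2 ≤ frobSq B :=
      Finset.single_le_sum (f := fun j => ∑ k, B j k ^ 2)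
        (fun _ _ => Finset.sum_nonneg fun _ _ => sq_nonneg _) (Finset.mem_univ j)
    rw [mul_pow, mul_pow, Real.sq_sqrt hF0.le, NNReal.coe_pow, div_le_div_iff₀ (by positivity)
      (by positivity)]
    calc (σ : ℝ) ^ 2 * (∑ k, B j k ^ 2) * (q : ℝ) ^ 4
        ≤ (σ : ℝ) ^ 2 * frobSq B * (q : ℝ) ^ 4 := by gcongr
      _ = _ := by ring
  have b3 : μ {ω | ∃ (i : Fin n) (j : Fin n), ω ∈ {ω | (q : ℝ) ^ 2 * (Real.sqrt m * (σ : ℝ) ^ 2) ≤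
      |(∑ k, W ω i k * W ω j k) - if i = j then m * (σ : ℝ) ^ 2 else 0|}} ≤
      ENNReal.ofReal (gaussianFourthMoment * (n / q)) := by
    refine measure_exists_exists_le hq0 hq hC fun i j => ?_
    refine (measure_le_abs_gram_sub_le h.law_W hindW i j (by positivity)).trans
      (ENNReal.ofReal_le_ofReal (le_of_eq ?_))
    rw [mul_pow, mul_pow, Real.sq_sqrt hm0.le]
    field_simp
  have b4 := measure_not_separated_le h.law_X hindX hv hn hp hq
  have hnn : (0 : ℝ) ≤ n / q := by positivity
  have hsum : ENNReal.ofReal ((7 + gaussianFourthMoment) * (n / q)) =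
      ENNReal.ofReal (1 * (n / q)) + ENNReal.ofReal (1 * (n / q)) +
        ENNReal.ofReal (gaussianFourthMoment * (n / q)) + ENNReal.ofReal (5 * (n / q)) := by
    rw [← ENNReal.ofReal_add (by positivity) (by positivity),
      ← ENNReal.ofReal_add (by positivity) (by positivity),
      ← ENNReal.ofReal_add (by positivity) (by positivity)]
    congr 1
    ring
  rw [hsum]
  refine le_trans (measure_mono ?_) ((measure_union_le _ _).trans (add_le_add
    ((measure_union_le _ _).trans (add_le_add ((measure_union_le _ _).trans
      (add_le_add b1 b2)) b3)) b4))
  intro ω hω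
  by_contra hout
  simp only [Set.mem_union, Set.mem_ofPred_eq, not_or, not_exists, not_and, not_lt, not_le]
    at hout
  obtain ⟨⟨⟨g1, g2⟩, g3⟩, g4⟩ := hout
  have hX : ∀ i j, |X ω i j| ≤ (q : ℝ) ^ 2 := fun i j => (g1 i j).le
  exact hω (mlPermutations_eq_singleton_of_bounds hσ hn hp hq hFσ hF hdir hX
    (fun i j => (g2 i j).le) (fun i j => (g3 i j).le) (g4 hX))

end UnlabeledSensing

theorem theorem3 :
    ∃ c₀ c₁ c₃ : ℝ, 0 < c₀ ∧ 0 < c₁ ∧ 0 < c₃ ∧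
      ∀ ε : ℝ, 0 < ε → ∃ N₁ : ℝ, 0 < N₁ ∧
        ∀ (n p m : ℕ), 0 < p → 0 < m → 2 * p ≤ n → N₁ < (n : ℝ) →
        ∀ (σ : ℝ≥0), 0 < σ →
        ∀ (B : Matrix (Fin p) (Fin m) ℝ) (π : Equiv.Perm (Fin n)),
          1 ≤ UnlabeledSensing.snr B σ * (n : ℝ) ^ (-(2 * (n : ℝ) / ((n : ℝ) - (p : ℝ)))) →
          (c₀ + c₁ * ε) * Real.log (n : ℝ) ≤ Real.log ((m : ℝ) * UnlabeledSensing.snr B σ) →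
        ∀ {Ω : Type*} [MeasurableSpace Ω] (μ : Measure Ω) [IsProbabilityMeasure μ]
          (X : Ω → Matrix (Fin n) (Fin p) ℝ) (W : Ω → Matrix (Fin n) (Fin m) ℝ),
          UnlabeledSensing.IsGaussianDesign μ X W σ →
          1 - c₃ * (n : ℝ) ^ (-ε) * max (((n : ℝ) ^ ε - 1)⁻¹) 1 <
            μ.real {ω | UnlabeledSensing.mlPermutations (X ω)
              (UnlabeledSensing.observation π (X ω) B (W ω)) = {π}} := by
  have hC := UnlabeledSensing.gaussianFourthMoment_nonneg
  refine ⟨620, 310, 8 + UnlabeledSensing.gaussianFourthMoment, by norm_num, by norm_num,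
    by positivity, fun ε hε => ⟨4, by norm_num, ?_⟩⟩
  intro n p m hp hm hpn hn σ hσ B π hsnr hlog Ω _ μ _ X W h
  have hn4 : 4 ≤ n := by exact_mod_cast hn.le
  have hn0 : (0 : ℝ) < n := by linarith
  have hn1 : (1 : ℝ) ≤ n := by linarith
  have hσ0 : (0 : ℝ) < σ := hσ
  have hm0 : (0 : ℝ) < m := Nat.cast_pos.2 hm
  have hpn' : (p : ℝ) < n := by exact_mod_cast (by omega : p < n)
  -- the power of `n` is at most `1`, so the signal-to-noise ratio is at least `1`
  have hsnr1 : 1 ≤ UnlabeledSensing.snr B σ := by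
    have hle : (n : ℝ) ^ (-(2 * (n : ℝ) / ((n : ℝ) - (p : ℝ)))) ≤ 1 := by
      refine Real.rpow_le_one_of_one_le_of_nonpos hn1 (neg_nonpos.2 ?_)
      exact div_nonneg (by positivity) (by linarith)
    have hs0 : 0 ≤ UnlabeledSensing.snr B σ :=
      div_nonneg (UnlabeledSensing.frobSq_nonneg B) (by positivity)
    exact hsnr.trans (mul_le_of_le_one_right hs0 hle)
  have hms : (m : ℝ) * UnlabeledSensing.snr B σ = UnlabeledSensing.frobSq B / (σ : ℝ) ^ 2 := by
    rw [UnlabeledSensing.snr]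
    field_simp
  have hFσ : (m : ℝ) * (σ : ℝ) ^ 2 ≤ UnlabeledSensing.frobSq B := by
    rwa [UnlabeledSensing.snr, one_le_div (by positivity)] at hsnr1
  set q : ℕ := ⌈(n : ℝ) ^ (1 + ε)⌉₊ with hq
  have hnε : (n : ℝ) ≤ (n : ℝ) ^ (1 + ε) := by
    simpa using Real.rpow_le_rpow_of_exponent_le hn1 (by linarith : (1 : ℝ) ≤ 1 + ε)
  have hq1 : (n : ℝ) ^ (1 + ε) ≤ q := Nat.le_ceil _
  have hnq : n ≤ q := by exact_mod_cast hnε.trans hq1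
  have hq2 : (q : ℝ) ≤ (n : ℝ) ^ (2 + ε) := by
    have h1 := (Nat.ceil_lt_add_one (by positivity : 0 ≤ (n : ℝ) ^ (1 + ε))).le
    rw [← hq] at h1
    have h2 : (n : ℝ) ^ (2 + ε) = n * (n : ℝ) ^ (1 + ε) := by
      rw [show 2 + ε = 1 + (1 + ε) by ring, Real.rpow_add hn0, Real.rpow_one]
    rw [h2]
    nlinarith
  have hF : ((q : ℝ) ^ 155 * σ) ^ 2 ≤ UnlabeledSensing.frobSq B := by
    have h1 : (n : ℝ) ^ (620 + 310 * ε) ≤ UnlabeledSensing.frobSq B / (σ : ℝ) ^ 2 := by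
      rw [hms, ← Real.log_rpow hn0] at hlog
      refine (Real.log_le_log_iff (by positivity) ?_).1 hlog
      rw [← hms]
      positivity
    rw [le_div_iff₀ (by positivity)] at h1
    refine le_trans ?_ h1
    rw [mul_pow, ← pow_mul]
    gcongr
    calc (q : ℝ) ^ (155 * 2) ≤ ((n : ℝ) ^ (2 + ε)) ^ (155 * 2) := by gcongr
      _ = (n : ℝ) ^ (620 + 310 * ε) := by
          rw [← Real.rpow_mul_natCast hn0.le]
          congr 1
          push_cast
          ring
  have hbad := UnlabeledSensing.measure_mlPermutations_ne_le hσ hm hn4 hpn hnq h π hFσ hF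
  set G := {ω | UnlabeledSensing.mlPermutations (X ω)
    (UnlabeledSensing.observation π (X ω) B (W ω)) = {π}} with hG
  have hbad' : μ.real Gᶜ ≤ (7 + UnlabeledSensing.gaussianFourthMoment) * (n / q) :=
    ENNReal.toReal_le_of_le_ofReal (by positivity) hbad
  have hone : 1 ≤ μ.real G + μ.real Gᶜ := by
    have := measureReal_union_le (μ := μ) G Gᶜ
    rwa [Set.union_compl_self, probReal_univ] at this
  have hpos : 0 < (n : ℝ) ^ (-ε) := by positivity
  have hratio : (n : ℝ) / q ≤ (n : ℝ) ^ (-ε) := by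
    rw [div_le_iff₀ (by linarith)]
    calc (n : ℝ) = (n : ℝ) ^ (-ε) * (n : ℝ) ^ (1 + ε) := by
          rw [← Real.rpow_add hn0]
          simp
      _ ≤ (n : ℝ) ^ (-ε) * q := by gcongr
  have hmax : (8 + UnlabeledSensing.gaussianFourthMoment) * (n : ℝ) ^ (-ε) ≤
      (8 + UnlabeledSensing.gaussianFourthMoment) * (n : ℝ) ^ (-ε) *
        max (((n : ℝ) ^ ε - 1)⁻¹) 1 :=
    le_mul_of_one_le_right (by positivity) (le_max_right _ _)
  have hfin : (7 + UnlabeledSensing.gaussianFourthMoment) * (n / q) ≤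
      (7 + UnlabeledSensing.gaussianFourthMoment) * (n : ℝ) ^ (-ε) := by gcongr
  linarith
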